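/- Let $X$ be a second-countable locally compact Hausdorff space, $\mathfrak M^+$ the cone of positive Radon measures on $X$, and $\kappa:X\times X\to[0,\infty]$ a kernel, that is, a symmetric lower semicontinuous function. Write $U^\mu(x)=\int\kappa(x,y)\,d\mu(y)$, $I(\mu,\nu)=\int\kappa\,d(\mu\otimes\nu)$, $I(\mu)=I(\mu,\mu)$. Let $\mathcal E^+$ be the set of all $\mu\in\mathfrak M^+$ with $I(\mu)<\infty$, and for $A\subset X$ let $\mathcal E^+(A)$ be the set of all $\mu\in\mathcal E^+$ for which $X\setminus A$ is $\mu$-negligible. The inner capacity of $A$ is $c_*(A)=\sup\{c(K):K\subset A\text{ compact}\}$, where $1/c(K)$ is the infimum of $I(\mu)$ over all $\mu\in\mathfrak M^+$ concentrated on $K$ with $\mu(X)=1$. A property holds nearly everywhere (n.e.) on $A$ if the set of $x\in A$ where it fails has inner capacity zero. Assume that $\kappa$ satisfies the energy principle ($I(\sigma)\ge0$ for every signed Radon measure $\sigma$ whose energy is well defined, with equality only for $\sigma=0$); the consistency principle ($\mathcal E^+$ is complete in the strong topology, given by $\|\mu-\nu\|=\sqrt{I(\mu-\nu)}$, and this topology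 is finer than the vague one on $\mathcal E^+$); the domination principle (if $\mu\in\mathcal E^+$, $\nu\in\mathfrak M^+$ and $U^\mu\le U^\nu$ $\mu$-a.e., then $U^\mu\le U^\nu$ on $X$); and Frostman's maximum principle (if $\mu\in\mathcal E^+$, $c\in(0,\infty)$ and $U^\mu\le c$ $\mu$-a.e., then $U^\mu\le c$ on $X$). Let $A\subset X$ be a set with $c_*(A)>0$ for which $\mathcal E^+(A)$ is strongly closed, and let $\omega\in\mathfrak M^+$, $\omega\neq0$, be such that either $\omega\in\mathcal E^+$, or $\omega(X)<\infty$, $U^\omega|_K$ is upper semicontinuous for every compact $K\subset A$, and $U^\omega$ is bounded on $A$. Put $$\Gamma_{A,\omega}=\{\nu\in\mathfrak M^+:\ U^\nu\ge U^\omega\ \text{n.e. on }A\}.$$ (1) There is exactly one measure $\omega^A\in\mathcal E^+(A)$ with $U^{\omega^A}=U^\omega$ n.e. on $A$ (the inner balayage of $\omega$ onto $A$), and it is of minimum total mass in $\Gamma_{A,\omega}\cap\mathcal E^+$: $\omega^A\in\Gamma_{A,\omega}\cap\mathcal E^+$ and $$\omega^A(X)=\min_{\mu\in\Gamma_{A,\omega}\cap\mathcal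 E^+}\mu(X).$$ (2) This extremal property does not determine $\omega^A$ uniquely: there are $X,\kappa,A,\omega$ satisfying all the above assumptions, with $\omega\in\mathcal E^+$ and $\omega(X)<\infty$, such that $\omega\ne\omega^A$, $\omega(X)=\omega^A(X)$, every measure $a\omega+b\omega^A$ with $a,b\ge0$, $a+b=1$, is of minimum total mass in $\Gamma_{A,\omega}\cap\mathcal E^+$, and thus infinitely many measures in $\Gamma_{A,\omega}\cap\mathcal E^+$ are of minimum total mass. -/

import Mathlib

open MeasureTheory Filter Topology
open scoped ENNReal NNReal

noncomputable section

namespace Balayage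

/-!
Throughout, `X` is a second-countable locally compact Hausdorff space with its Borel sets. On such a
space the positive Radon measures are the Borel measures that are locally finite (equivalently,
finite on compact sets), and every signed Radon measure is a difference `μ - ν` of two of them.
-/

variable {X : Type*} [TopologicalSpace X] [MeasurableSpace X]

/-- The potential `U^μ(x) = ∫ κ(x,y) dμ(y)` of a positive measure. -/
def potential (κ : X → X → ℝ≥0∞) (μ : Measure X) (x : X) : ℝ≥0∞ :=
  ∫⁻ y, κ x y ∂μ

/-- The mutual energy `I(μ,ν) = ∫ κ d(μ ⊗ ν)` of two positive measures. -/
def mutualEnergy (κ : X → X → ℝ≥0∞) (μ ν : Measure X) : ℝ≥0∞ :=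
  ∫⁻ p, κ p.1 p.2 ∂(μ.prod ν)

/-- The energy `I(μ) = I(μ,μ)` of a positive measure. -/
def energy (κ : X → X → ℝ≥0∞) (μ : Measure X) : ℝ≥0∞ :=
  mutualEnergy κ μ μ

/-- The cone `𝔐⁺` of all positive Radon measures on `X`. -/
def radonPos (X : Type*) [TopologicalSpace X] [MeasurableSpace X] : Set (Measure X) :=
  {μ | IsLocallyFiniteMeasure μ}

/-- The cone `ℰ⁺` of all positive Radon measures of finite energy. -/
def energyCone (κ : X → X → ℝ≥0∞) : Set (Measure X) :=
  {μ | μ ∈ radonPos X ∧ energy κ μ < ⊤}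

/-- The cone `ℰ⁺(A)` of all `μ ∈ ℰ⁺` concentrated on `A`, that is, with `X \ A` being
`μ`-negligible; `A` is arbitrary, and `μ Aᶜ` is the outer measure. -/
def energyConeOn (κ : X → X → ℝ≥0∞) (A : Set X) : Set (Measure X) :=
  {μ | μ ∈ energyCone κ ∧ μ Aᶜ = 0}

/-- The capacity of a compact set, `1 / inf I(μ)` over the positive Radon measures `μ` of unit total
mass concentrated on `K` (the infimum over the empty family being `∞`). -/
def compactCapacity (κ : X → X → ℝ≥0∞) (K : Set X) : ℝ≥0∞ :=
  (⨅ μ ∈ {μ : Measure X | μ ∈ radonPos X ∧ μ Set.univ = 1 ∧ μ Kᶜ = 0}, energy κ μ)⁻¹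

/-- The inner capacity `c_*(A)`: the supremum of the capacities of the compact subsets of `A`. -/
def innerCapacity (κ : X → X → ℝ≥0∞) (A : Set X) : ℝ≥0∞ :=
  ⨆ K ∈ {K : Set X | IsCompact K ∧ K ⊆ A}, compactCapacity κ K

/-- The property `P` holds nearly everywhere (n.e.) on `A`: the set of all `x ∈ A` where it fails is
of inner capacity zero. -/
def NearlyEverywhereOn (κ : X → X → ℝ≥0∞) (A : Set X) (P : X → Prop) : Prop :=
  innerCapacity κ {x | x ∈ A ∧ ¬ P x} = 0

/-- The square `‖μ - ν‖² = I(μ) - 2 I(μ,ν) + I(ν)` of the strong (energy) distance between two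
measures of class `ℰ⁺`. -/
def strongDistSq (κ : X → X → ℝ≥0∞) (μ ν : Measure X) : ℝ :=
  (energy κ μ).toReal - 2 * (mutualEnergy κ μ ν).toReal + (energy κ ν).toReal

/-- Strong convergence of a sequence of measures of class `ℰ⁺` to a measure of class `ℰ⁺`. -/
def StrongTendsto (κ : X → X → ℝ≥0∞) (μ : ℕ → Measure X) (μ₀ : Measure X) : Prop :=
  Tendsto (fun j => strongDistSq κ (μ j) μ₀) atTop (𝓝 0)

/-- A sequence of measures of class `ℰ⁺` is strong Cauchy. -/
def StrongCauchy (κ : X → X → ℝ≥0∞) (μ : ℕ → Measure X) : Prop :=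
  ∀ ε : ℝ, 0 < ε → ∃ N : ℕ, ∀ i ≥ N, ∀ j ≥ N, strongDistSq κ (μ i) (μ j) < ε

/-- Vague convergence of a sequence of positive Radon measures. -/
def VagueTendsto (μ : ℕ → Measure X) (μ₀ : Measure X) : Prop :=
  ∀ φ : X → ℝ, Continuous φ → HasCompactSupport φ →
    Tendsto (fun j => ∫ x, φ x ∂(μ j)) atTop (𝓝 (∫ x, φ x ∂μ₀))

/-- The energy principle (strict positive definiteness): `I(σ) ≥ 0` for every signed Radon measure
`σ` whose energy is well defined, with `I(σ) = 0` only for `σ = 0`. A signed measure is written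
as `σ = μ - ν`, so that `I(σ) = I(μ) + I(ν) - 2 I(μ,ν)`; where `I(μ) + I(ν) = ∞`, the inequality
carries no information, and the finite part carries the requirement. -/
def EnergyPrinciple (κ : X → X → ℝ≥0∞) : Prop :=
  ∀ μ ∈ radonPos X, ∀ ν ∈ radonPos X,
    2 * mutualEnergy κ μ ν ≤ energy κ μ + energy κ ν ∧
    (energy κ μ + energy κ ν < ⊤ →
      2 * mutualEnergy κ μ ν = energy κ μ + energy κ ν → μ = ν)

/-- The consistency principle: `ℰ⁺` is complete in the strong topology, and the strong topology on
`ℰ⁺` is finer than the vague one. The strong topology being given by a metric, both are expressed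
through sequences. -/
def ConsistencyPrinciple (κ : X → X → ℝ≥0∞) : Prop :=
  (∀ μ : ℕ → Measure X, (∀ j, μ j ∈ energyCone κ) → StrongCauchy κ μ →
    ∃ μ₀ ∈ energyCone κ, StrongTendsto κ μ μ₀) ∧
  (∀ (μ : ℕ → Measure X) (μ₀ : Measure X), (∀ j, μ j ∈ energyCone κ) → μ₀ ∈ energyCone κ →
    StrongTendsto κ μ μ₀ → VagueTendsto μ μ₀)

/-- The domination principle. -/
def DominationPrinciple (κ : X → X → ℝ≥0∞) : Prop :=
  ∀ μ ∈ energyCone κ, ∀ ν ∈ radonPos X,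
    (∀ᵐ x ∂μ, potential κ μ x ≤ potential κ ν x) → ∀ x, potential κ μ x ≤ potential κ ν x

/-- Ugaheri's maximum principle with the constant `M`. -/
def UgaheriPrinciple (κ : X → X → ℝ≥0∞) (M : ℝ≥0) : Prop :=
  ∀ μ ∈ energyCone κ, ∀ c : ℝ≥0, 0 < c →
    (∀ᵐ x ∂μ, potential κ μ x ≤ c) → ∀ x, potential κ μ x ≤ M * c

/-- Frostman's maximum principle: Ugaheri's maximum principle with `M = 1`. -/
def FrostmanPrinciple (κ : X → X → ℝ≥0∞) : Prop :=
  UgaheriPrinciple κ 1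

/-- The standing assumptions on a kernel: a symmetric, lower semicontinuous function
`κ : X × X → [0, ∞]` that satisfies the energy, consistency, and domination principles, and Ugaheri's
maximum principle with some constant `M ∈ [1, ∞)`. -/
structure AdmissibleKernel (κ : X → X → ℝ≥0∞) : Prop where
  symm : ∀ x y, κ x y = κ y x
  lsc : LowerSemicontinuous fun p : X × X => κ p.1 p.2
  energy_principle : EnergyPrinciple κ
  consistency : ConsistencyPrinciple κ
  domination : DominationPrinciple κ
  ugaheri : ∃ M : ℝ≥0, 1 ≤ M ∧ UgaheriPrinciple κ M

/-- The standing assumptions on a set: `A` is of nonzero inner capacity, and the cone `ℰ⁺(A)` is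
strongly closed. -/
structure AdmissibleSet (κ : X → X → ℝ≥0∞) (A : Set X) : Prop where
  capacity_pos : 0 < innerCapacity κ A
  strongly_closed : ∀ (μ : ℕ → Measure X) (μ₀ : Measure X), (∀ j, μ j ∈ energyConeOn κ A) →
    μ₀ ∈ energyCone κ → StrongTendsto κ μ μ₀ → μ₀ ∈ energyConeOn κ A

/-- The standing assumptions on the measure to be swept: `ω` is a nonzero positive Radon measure, and
either it is of finite energy, or it is bounded, its potential is upper semicontinuous on every compact
subset of `A`, and its potential is bounded on `A`. -/
structure AdmissibleMeasure (κ : X → X → ℝ≥0∞) (A : Set X) (ω : Measure X) : Prop where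
  radon : ω ∈ radonPos X
  ne_zero : ω ≠ 0
  finite_energy_or : ω ∈ energyCone κ ∨
    (ω Set.univ < ⊤ ∧
      (∀ K : Set X, IsCompact K → K ⊆ A → UpperSemicontinuousOn (potential κ ω) K) ∧
      ∃ m : ℝ≥0, ∀ x ∈ A, potential κ ω x ≤ m)

/-- `ν` is the inner balayage `ω^A` of `ω` onto `A`: it belongs to `ℰ⁺(A)`, and `U^ν = U^ω` n.e. on
`A`. -/
def IsInnerBalayage (κ : X → X → ℝ≥0∞) (A : Set X) (ω ν : Measure X) : Prop :=
  ν ∈ energyConeOn κ A ∧ NearlyEverywhereOn κ A fun x => potential κ ν x = potential κ ω x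

/-- The class `Γ_{A,ω}` of all `ν ∈ 𝔐⁺` with `U^ν ≥ U^ω` n.e. on `A`. -/
def GammaClass (κ : X → X → ℝ≥0∞) (A : Set X) (ω : Measure X) : Set (Measure X) :=
  {ν | ν ∈ radonPos X ∧ NearlyEverywhereOn κ A fun x => potential κ ω x ≤ potential κ ν x}

/-- `μ` is of minimum total mass in the class `Γ_{A,ω} ∩ ℰ⁺` (and belongs to that class). -/
def HasMinimumMass (κ : X → X → ℝ≥0∞) (A : Set X) (ω μ : Measure X) : Prop :=
  μ ∈ GammaClass κ A ω ∩ energyCone κ ∧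
    ∀ ν ∈ GammaClass κ A ω ∩ energyCone κ, μ Set.univ ≤ ν Set.univ

end Balayage

end

set_option linter.unusedSectionVars false

/-! Sweeping is a projection onto the cone `ℰ⁺(A)`. The Gauss functional `I(ν) - 2 ∫ U^ω dν` is
minimised over that cone. By the parallelogram identity a minimising sequence is strong Cauchy, so
completeness and strong closedness provide a minimiser `P`. Varying `P` along `P + tν` and along
`tP` gives `U^P ≥ U^ω` almost everywhere for every measure in `ℰ⁺(A)`, and equality `P`-a.e. The
domination principle turns the latter into `U^P ≤ U^ω` everywhere. So the potentials agree n.e. on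
`A` (`AdmissibleKernel.exists_swept`), and the energy principle gives uniqueness.

The minimisation needs `ν ↦ ∫ U^ω dν` to be strongly continuous on `ℰ⁺(A)`. For `ω` of finite energy
this is the Cauchy–Schwarz inequality. For bounded `ω`, possibly of infinite energy, `ω` is first
swept onto compact subsets of `A`. The swept measures have uniformly bounded energy, which gives a
Lipschitz bound that survives an exhaustion (`AdmissibleKernel.strongFunctional_of_bounded`).

Minimality of the mass is the principle of positivity of mass (`AdmissibleKernel.measure_univ_le`):
inequality of potentials is integrated against the equilibrium measure `γ` of a compact `K ⊆ A`,
where `U^γ ≥ 1` a.e. on `K`, and Frostman's principle gives `U^γ ≤ 1` everywhere.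

For non-uniqueness, take two points and the kernel with Gram matrix `[[1, 1], [1, 2]]`. The
potential at `false` is the total mass, so for `A = {false}` and a unit mass at `true` the
minimisers are exactly the measures of mass one. -/

namespace Balayage

section General

variable {X : Type*} [TopologicalSpace X] [T2Space X] [LocallyCompactSpace X]
  [SecondCountableTopology X] [MeasurableSpace X] [BorelSpace X] {κ : X → X → ℝ≥0∞}
  {A K : Set X} {μ ν ρ ω : Measure X} {g : X → ℝ≥0∞}

/-! ### Mutual energy on the cone of Radon measures. -/

theorem AdmissibleKernel.measurable (hκ : AdmissibleKernel κ) :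
    Measurable fun p : X × X => κ p.1 p.2 :=
  hκ.lsc.measurable

theorem AdmissibleKernel.measurable_potential (hκ : AdmissibleKernel κ) (hμ : μ ∈ radonPos X) :
    Measurable (potential κ μ) := by
  have : IsLocallyFiniteMeasure μ := hμ
  exact hκ.measurable.lintegral_prod_right'

theorem AdmissibleKernel.mutualEnergy_eq (hκ : AdmissibleKernel κ) (hμ : μ ∈ radonPos X)
    (hν : ν ∈ radonPos X) : mutualEnergy κ μ ν = ∫⁻ x, potential κ ν x ∂μ := by
  have : IsLocallyFiniteMeasure μ := hμ
  have : IsLocallyFiniteMeasure ν := hν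
  exact lintegral_prod _ hκ.measurable.aemeasurable

theorem AdmissibleKernel.mutualEnergy_comm (hκ : AdmissibleKernel κ) (hμ : μ ∈ radonPos X)
    (hν : ν ∈ radonPos X) : mutualEnergy κ μ ν = mutualEnergy κ ν μ := by
  have : IsLocallyFiniteMeasure μ := hμ
  have : IsLocallyFiniteMeasure ν := hν
  rw [hκ.mutualEnergy_eq hμ hν, mutualEnergy, lintegral_prod_symm _ hκ.measurable.aemeasurable]
  simp only [potential, hκ.symm]

theorem add_mem_radonPos (hμ : μ ∈ radonPos X) (hν : ν ∈ radonPos X) : μ + ν ∈ radonPos X := by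
  have : IsLocallyFiniteMeasure μ := hμ
  have : IsLocallyFiniteMeasure ν := hν
  refine ⟨fun x => ?_⟩
  obtain ⟨s, hs, hs'⟩ := μ.finiteAt_nhds x
  obtain ⟨t, ht, ht'⟩ := ν.finiteAt_nhds x
  refine ⟨s ∩ t, inter_mem hs ht, ?_⟩
  rw [Measure.add_apply]
  exact ENNReal.add_lt_top.2 ⟨(measure_mono Set.inter_subset_left).trans_lt hs',
    (measure_mono Set.inter_subset_right).trans_lt ht'⟩

theorem smul_mem_radonPos (c : ℝ≥0) (hμ : μ ∈ radonPos X) : c • μ ∈ radonPos X := by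
  have : IsLocallyFiniteMeasure μ := hμ
  exact (inferInstance : IsLocallyFiniteMeasure (c • μ))

theorem mem_radonPos_of_le (hμ : μ ∈ radonPos X) (h : ν ≤ μ) : ν ∈ radonPos X := by
  have : IsLocallyFiniteMeasure μ := hμ
  exact Measure.isLocallyFiniteMeasure_of_le h

theorem AdmissibleKernel.mutualEnergy_add_left (hκ : AdmissibleKernel κ) (hμ : μ ∈ radonPos X)
    (hν : ν ∈ radonPos X) (hρ : ρ ∈ radonPos X) :
    mutualEnergy κ (μ + ν) ρ = mutualEnergy κ μ ρ + mutualEnergy κ ν ρ := by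
  rw [hκ.mutualEnergy_eq (add_mem_radonPos hμ hν) hρ, hκ.mutualEnergy_eq hμ hρ,
    hκ.mutualEnergy_eq hν hρ, lintegral_add_measure]

theorem AdmissibleKernel.mutualEnergy_smul_left (hκ : AdmissibleKernel κ) (c : ℝ≥0)
    (hμ : μ ∈ radonPos X) (hρ : ρ ∈ radonPos X) :
    mutualEnergy κ (c • μ) ρ = c * mutualEnergy κ μ ρ := by
  rw [hκ.mutualEnergy_eq (smul_mem_radonPos c hμ) hρ, hκ.mutualEnergy_eq hμ hρ,
    lintegral_smul_measure, ENNReal.smul_def, smul_eq_mul]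

theorem AdmissibleKernel.mutualEnergy_mono_left (hκ : AdmissibleKernel κ) (hμ : μ ∈ radonPos X)
    (hρ : ρ ∈ radonPos X) (h : ν ≤ μ) : mutualEnergy κ ν ρ ≤ mutualEnergy κ μ ρ := by
  rw [hκ.mutualEnergy_eq (mem_radonPos_of_le hμ h) hρ, hκ.mutualEnergy_eq hμ hρ]
  exact lintegral_mono' h le_rfl

/-- The energy principle bounds `2 I(μ,ν)` by `I(μ) + I(ν)`. This is what allows the passage to
real-valued pairings. -/
theorem AdmissibleKernel.mutualEnergy_ne_top (hκ : AdmissibleKernel κ) (hμ : μ ∈ energyCone κ)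
    (hν : ν ∈ energyCone κ) : mutualEnergy κ μ ν ≠ ⊤ := by
  intro h
  have := (hκ.energy_principle μ hμ.1 ν hν.1).1
  rw [h, ENNReal.mul_top two_ne_zero, top_le_iff] at this
  exact (ENNReal.add_lt_top.2 ⟨hμ.2, hν.2⟩).ne this

theorem AdmissibleKernel.mem_energyCone_of_le (hκ : AdmissibleKernel κ) (hμ : μ ∈ energyCone κ)
    (h : ν ≤ μ) : ν ∈ energyCone κ := by
  have hν := mem_radonPos_of_le hμ.1 h
  refine ⟨hν, lt_of_le_of_lt ?_ hμ.2⟩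
  calc mutualEnergy κ ν ν ≤ mutualEnergy κ μ ν := hκ.mutualEnergy_mono_left hμ.1 hν h
    _ = mutualEnergy κ ν μ := hκ.mutualEnergy_comm hμ.1 hν
    _ ≤ mutualEnergy κ μ μ := hκ.mutualEnergy_mono_left hμ.1 hμ.1 h

theorem AdmissibleKernel.mutualEnergy_add_right (hκ : AdmissibleKernel κ) (hμ : μ ∈ radonPos X)
    (hν : ν ∈ radonPos X) (hρ : ρ ∈ radonPos X) :
    mutualEnergy κ ρ (μ + ν) = mutualEnergy κ ρ μ + mutualEnergy κ ρ ν := by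
  rw [hκ.mutualEnergy_comm hρ (add_mem_radonPos hμ hν), hκ.mutualEnergy_add_left hμ hν hρ,
    hκ.mutualEnergy_comm hμ hρ, hκ.mutualEnergy_comm hν hρ]

theorem AdmissibleKernel.mutualEnergy_smul_right (hκ : AdmissibleKernel κ) (c : ℝ≥0)
    (hμ : μ ∈ radonPos X) (hρ : ρ ∈ radonPos X) :
    mutualEnergy κ ρ (c • μ) = c * mutualEnergy κ ρ μ := by
  rw [hκ.mutualEnergy_comm hρ (smul_mem_radonPos c hμ), hκ.mutualEnergy_smul_left c hμ hρ,
    hκ.mutualEnergy_comm hμ hρ]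

theorem AdmissibleKernel.add_mem_energyCone (hκ : AdmissibleKernel κ) (hμ : μ ∈ energyCone κ)
    (hν : ν ∈ energyCone κ) : μ + ν ∈ energyCone κ := by
  have h := add_mem_radonPos hμ.1 hν.1
  refine ⟨h, ?_⟩
  rw [energy, hκ.mutualEnergy_add_left hμ.1 hν.1 h, hκ.mutualEnergy_add_right hμ.1 hν.1 hμ.1,
    hκ.mutualEnergy_add_right hμ.1 hν.1 hν.1]
  rw [lt_top_iff_ne_top]
  simp [hκ.mutualEnergy_ne_top, hμ, hν]

theorem AdmissibleKernel.smul_mem_energyCone (hκ : AdmissibleKernel κ) (c : ℝ≥0)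
    (hμ : μ ∈ energyCone κ) : c • μ ∈ energyCone κ := by
  have h := smul_mem_radonPos c hμ.1
  refine ⟨h, ?_⟩
  rw [energy, hκ.mutualEnergy_smul_left c hμ.1 h, hκ.mutualEnergy_smul_right c hμ.1 hμ.1]
  exact ENNReal.mul_lt_top ENNReal.coe_lt_top (ENNReal.mul_lt_top ENNReal.coe_lt_top hμ.2)

theorem zero_mem_energyCone : (0 : Measure X) ∈ energyCone κ := by
  refine ⟨(inferInstance : IsLocallyFiniteMeasure (0 : Measure X)), ?_⟩
  simp [energy, mutualEnergy]

theorem AdmissibleKernel.add_mem_energyConeOn (hκ : AdmissibleKernel κ)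
    (hμ : μ ∈ energyConeOn κ A) (hν : ν ∈ energyConeOn κ A) : μ + ν ∈ energyConeOn κ A :=
  ⟨hκ.add_mem_energyCone hμ.1 hν.1, by rw [Measure.add_apply, hμ.2, hν.2, add_zero]⟩

theorem AdmissibleKernel.smul_mem_energyConeOn (hκ : AdmissibleKernel κ) (c : ℝ≥0)
    (hμ : μ ∈ energyConeOn κ A) : c • μ ∈ energyConeOn κ A :=
  ⟨hκ.smul_mem_energyCone c hμ.1, by rw [Measure.smul_apply, hμ.2, smul_zero]⟩

theorem zero_mem_energyConeOn : (0 : Measure X) ∈ energyConeOn κ A :=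
  ⟨zero_mem_energyCone, rfl⟩

theorem AdmissibleKernel.mem_energyConeOn_of_le (hκ : AdmissibleKernel κ)
    (hμ : μ ∈ energyConeOn κ A) (h : ν ≤ μ) : ν ∈ energyConeOn κ A :=
  ⟨hκ.mem_energyCone_of_le hμ.1 h, le_antisymm ((h _).trans hμ.2.le) zero_le⟩

theorem energyConeOn_mono {B : Set X} (h : A ⊆ B) : energyConeOn κ A ⊆ energyConeOn κ B :=
  fun _ hμ => ⟨hμ.1, measure_mono_null (Set.compl_subset_compl.2 h) hμ.2⟩

/-! ### The pre-Hilbert structure on measures of finite energy. -/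

/-- The mutual energy as a real number. -/
noncomputable def pairing (κ : X → X → ℝ≥0∞) (μ ν : Measure X) : ℝ := (mutualEnergy κ μ ν).toReal

theorem pairing_nonneg : 0 ≤ pairing κ μ ν := ENNReal.toReal_nonneg

theorem strongDistSq_eq :
    strongDistSq κ μ ν = pairing κ μ μ - 2 * pairing κ μ ν + pairing κ ν ν := rfl

theorem AdmissibleKernel.pairing_comm (hκ : AdmissibleKernel κ) (hμ : μ ∈ energyCone κ)
    (hν : ν ∈ energyCone κ) : pairing κ μ ν = pairing κ ν μ := by
  rw [pairing, hκ.mutualEnergy_comm hμ.1 hν.1, pairing]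

theorem AdmissibleKernel.pairing_add_left (hκ : AdmissibleKernel κ) (hμ : μ ∈ energyCone κ)
    (hν : ν ∈ energyCone κ) (hρ : ρ ∈ energyCone κ) :
    pairing κ (μ + ν) ρ = pairing κ μ ρ + pairing κ ν ρ := by
  rw [pairing, hκ.mutualEnergy_add_left hμ.1 hν.1 hρ.1, ENNReal.toReal_add
    (hκ.mutualEnergy_ne_top hμ hρ) (hκ.mutualEnergy_ne_top hν hρ)]
  rfl

theorem AdmissibleKernel.pairing_add_right (hκ : AdmissibleKernel κ) (hμ : μ ∈ energyCone κ)
    (hν : ν ∈ energyCone κ) (hρ : ρ ∈ energyCone κ) :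
    pairing κ ρ (μ + ν) = pairing κ ρ μ + pairing κ ρ ν := by
  rw [hκ.pairing_comm hρ (hκ.add_mem_energyCone hμ hν), hκ.pairing_add_left hμ hν hρ,
    hκ.pairing_comm hμ hρ, hκ.pairing_comm hν hρ]

theorem AdmissibleKernel.pairing_smul_left (hκ : AdmissibleKernel κ) (c : ℝ≥0)
    (hμ : μ ∈ energyCone κ) (hρ : ρ ∈ energyCone κ) :
    pairing κ (c • μ) ρ = c * pairing κ μ ρ := by
  rw [pairing, hκ.mutualEnergy_smul_left c hμ.1 hρ.1, ENNReal.toReal_mul]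
  rfl

theorem AdmissibleKernel.pairing_smul_right (hκ : AdmissibleKernel κ) (c : ℝ≥0)
    (hμ : μ ∈ energyCone κ) (hρ : ρ ∈ energyCone κ) :
    pairing κ ρ (c • μ) = c * pairing κ ρ μ := by
  rw [hκ.pairing_comm hρ (hκ.smul_mem_energyCone c hμ), hκ.pairing_smul_left c hμ hρ,
    hκ.pairing_comm hμ hρ]

theorem AdmissibleKernel.strongDistSq_nonneg (hκ : AdmissibleKernel κ) (hμ : μ ∈ energyCone κ)
    (hν : ν ∈ energyCone κ) : 0 ≤ strongDistSq κ μ ν := by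
  have h := (hκ.energy_principle μ hμ.1 ν hν.1).1
  have h2 := ENNReal.toReal_mono (ENNReal.add_lt_top.2 ⟨hμ.2, hν.2⟩).ne h
  rw [ENNReal.toReal_add hμ.2.ne hν.2.ne, ENNReal.toReal_mul] at h2
  simp only [ENNReal.toReal_ofNat] at h2
  rw [strongDistSq]
  linarith

theorem AdmissibleKernel.strongDistSq_add_smul_left (hκ : AdmissibleKernel κ)
    (hμ : μ ∈ energyCone κ) (hν : ν ∈ energyCone κ) (hρ : ρ ∈ energyCone κ) (t : ℝ≥0) :
    strongDistSq κ (μ + t • ρ) ν = strongDistSq κ μ ν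
      + 2 * t * (pairing κ μ ρ - pairing κ ν ρ) + t ^ 2 * pairing κ ρ ρ := by
  have ht := hκ.smul_mem_energyCone t hρ
  rw [strongDistSq_eq, strongDistSq_eq, hκ.pairing_add_left hμ ht (hκ.add_mem_energyCone hμ ht),
    hκ.pairing_add_right hμ ht hμ, hκ.pairing_add_right hμ ht ht, hκ.pairing_add_left hμ ht hν,
    hκ.pairing_smul_left t hρ hμ, hκ.pairing_smul_left t hρ ht, hκ.pairing_smul_left t hρ hν,
    hκ.pairing_smul_right t hρ hμ, hκ.pairing_smul_right t hρ hρ, hκ.pairing_comm hρ hμ,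
    hκ.pairing_comm hρ hν]
  ring

theorem AdmissibleKernel.strongDistSq_comm (hκ : AdmissibleKernel κ) (hμ : μ ∈ energyCone κ)
    (hν : ν ∈ energyCone κ) : strongDistSq κ μ ν = strongDistSq κ ν μ := by
  rw [strongDistSq_eq, strongDistSq_eq, hκ.pairing_comm hμ hν]
  ring

/-- The Cauchy–Schwarz inequality for the signed measure `μ - ν` and the measure `ρ`. -/
theorem AdmissibleKernel.sq_pairing_sub_le (hκ : AdmissibleKernel κ)
    (hμ : μ ∈ energyCone κ) (hν : ν ∈ energyCone κ) (hρ : ρ ∈ energyCone κ) :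
    (pairing κ μ ρ - pairing κ ν ρ) ^ 2 ≤ strongDistSq κ μ ν * pairing κ ρ ρ := by
  have key : ∀ x : ℝ, 0 ≤ pairing κ ρ ρ * (x * x) + 2 * (pairing κ μ ρ - pairing κ ν ρ) * x
      + strongDistSq κ μ ν := by
    -- Only nonnegative multiples of `ρ` are available as measures, so for negative `x` the multiple
    -- of `ρ` is added to `ν` instead of `μ`.
    intro x
    rcases le_total 0 x with hx | hx
    · lift x to ℝ≥0 using hx
      have h := hκ.strongDistSq_nonneg (hκ.add_mem_energyCone hμ (hκ.smul_mem_energyCone x hρ)) hν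
      rw [hκ.strongDistSq_add_smul_left hμ hν hρ] at h
      linarith
    · obtain ⟨y, rfl⟩ : ∃ y, x = -y := ⟨-x, (neg_neg x).symm⟩
      lift y to ℝ≥0 using neg_nonpos.1 hx
      have h := hκ.strongDistSq_nonneg (hκ.add_mem_energyCone hν (hκ.smul_mem_energyCone y hρ)) hμ
      rw [hκ.strongDistSq_add_smul_left hν hμ hρ, hκ.strongDistSq_comm hν hμ] at h
      linarith
  have h := discrim_le_zero key
  rw [discrim] at h
  linarith

theorem AdmissibleKernel.eq_of_pairing_eq (hκ : AdmissibleKernel κ) (hμ : μ ∈ energyCone κ)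
    (hν : ν ∈ energyCone κ) (h₁ : pairing κ μ μ = pairing κ μ ν)
    (h₂ : pairing κ ν ν = pairing κ μ ν) : μ = ν := by
  have e1 := (ENNReal.toReal_eq_toReal_iff' (hκ.mutualEnergy_ne_top hμ hμ)
    (hκ.mutualEnergy_ne_top hμ hν)).1 h₁
  have e2 := (ENNReal.toReal_eq_toReal_iff' (hκ.mutualEnergy_ne_top hν hν)
    (hκ.mutualEnergy_ne_top hμ hν)).1 h₂
  refine (hκ.energy_principle μ hμ.1 ν hν.1).2 (ENNReal.add_lt_top.2 ⟨hμ.2, hν.2⟩) ?_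
  rw [energy, energy, e1, e2, two_mul]

/-! ### Nearly everywhere versus almost everywhere. -/

theorem compactCapacity_ne_zero {K : Set X} (hμ : μ ∈ energyConeOn κ K)
    (h1 : μ Set.univ = 1) : compactCapacity κ K ≠ 0 := by
  rw [compactCapacity, Ne, ENNReal.inv_eq_zero]
  exact ((iInf₂_le μ ⟨hμ.1.1, h1, hμ.2⟩).trans_lt hμ.1.2).ne

theorem exists_of_compactCapacity_ne_zero {K : Set X} (h : compactCapacity κ K ≠ 0) :
    ∃ μ ∈ energyConeOn κ K, μ Set.univ = 1 := by
  rw [compactCapacity, Ne, ENNReal.inv_eq_zero] at h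
  by_contra! hc
  refine h (iInf₂_eq_top.2 fun μ hμ => ?_)
  by_contra hlt
  exact hc μ ⟨⟨hμ.1, lt_top_iff_ne_top.2 hlt⟩, hμ.2.2⟩ hμ.2.1

theorem exists_isCompact_measure_ne_zero (hμ : μ ∈ radonPos X) {S : Set X}
    (hS : MeasurableSet S) (h : μ S ≠ 0) : ∃ K ⊆ S, IsCompact K ∧ μ K ≠ 0 := by
  have : IsLocallyFiniteMeasure μ := hμ
  by_contra! hc
  refine h ?_
  rw [hS.measure_eq_iSup_isCompact μ]
  simp only [ENNReal.iSup_eq_zero]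
  exact hc

/-- If the exceptional set had positive measure, it would contain a compact subset of `A` of
positive measure. The normalised restriction of `μ` to it has finite energy, which contradicts zero
inner capacity. Since `A` need not be measurable, a measurable null hull of its complement is
removed first. -/
theorem AdmissibleKernel.ae_of_nearlyEverywhereOn (hκ : AdmissibleKernel κ) {P : X → Prop}
    (hP : MeasurableSet {x | P x}) (h : NearlyEverywhereOn κ A P) (hμ : μ ∈ energyConeOn κ A) :
    ∀ᵐ x ∂μ, P x := by
  by_contra hc
  rw [ae_iff] at hc
  have hS : MeasurableSet ({x | ¬ P x} \ toMeasurable μ Aᶜ) :=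
    hP.compl.diff (measurableSet_toMeasurable _ _)
  have hne : μ ({x | ¬ P x} \ toMeasurable μ Aᶜ) ≠ 0 := by
    rwa [measure_sdiff_null ((measure_toMeasurable _).trans hμ.2)]
  obtain ⟨K, hKS, hK, hK0⟩ := exists_isCompact_measure_ne_zero hμ.1.1 hS hne
  have : IsLocallyFiniteMeasure μ := hμ.1.1
  have hKt : μ K ≠ ⊤ := hK.measure_lt_top.ne
  have hmem : (μ K).toNNReal⁻¹ • μ.restrict K ∈ energyConeOn κ K := by
    refine hκ.smul_mem_energyConeOn _ ⟨hκ.mem_energyCone_of_le hμ.1 Measure.restrict_le_self, ?_⟩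
    rw [Measure.restrict_apply hK.measurableSet.compl, Set.compl_inter_self, measure_empty]
  refine compactCapacity_ne_zero hmem ?_ ?_
  · rw [Measure.smul_apply, Measure.restrict_apply_univ, ENNReal.smul_def, smul_eq_mul,
      ENNReal.coe_inv (by simp [ENNReal.toNNReal_eq_zero_iff, hK0, hKt]),
      ENNReal.coe_toNNReal hKt, ENNReal.inv_mul_cancel hK0 hKt]
  · rw [NearlyEverywhereOn, innerCapacity, ENNReal.iSup_eq_zero] at h
    have h' := h K
    rw [ENNReal.iSup_eq_zero] at h'
    refine h' ⟨hK, fun x hx => ⟨?_, (hKS hx).1⟩⟩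
    by_contra hxA
    exact (hKS hx).2 (subset_toMeasurable _ _ hxA)

/-- A compact part of the exceptional set with nonzero capacity would carry a unit measure of finite
energy, for which `P` fails almost everywhere. No measurability of `P` is needed. -/
theorem nearlyEverywhereOn_of_ae {P : X → Prop} (h : ∀ μ ∈ energyConeOn κ A, ∀ᵐ x ∂μ, P x) :
    NearlyEverywhereOn κ A P := by
  rw [NearlyEverywhereOn, innerCapacity, ENNReal.iSup_eq_zero]
  intro K
  rw [ENNReal.iSup_eq_zero]
  intro hK
  by_contra hc
  obtain ⟨μ, hμ, h1⟩ := exists_of_compactCapacity_ne_zero hc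
  have hP := h μ (energyConeOn_mono (fun x hx => (hK.2 hx).1) hμ)
  have : ∀ᵐ x ∂μ, False := by
    filter_upwards [hP, (mem_ae_iff.2 (by simpa using hμ.2) : K ∈ ae μ)] with x hx hxK
    exact (hK.2 hxK).2 hx
  rw [ae_iff] at this
  simp [h1] at this

/-! ### The Gauss variational problem. -/

/-- `ℰ⁺(A)` is strongly closed. -/
def StronglyClosedOn (κ : X → X → ℝ≥0∞) (A : Set X) : Prop :=
  ∀ (μ : ℕ → Measure X) (μ₀ : Measure X), (∀ j, μ j ∈ energyConeOn κ A) →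
    μ₀ ∈ energyCone κ → StrongTendsto κ μ μ₀ → μ₀ ∈ energyConeOn κ A

/-- The integral of `g` is a finite, strongly bounded, strongly continuous functional on `ℰ⁺(A)`. -/
structure StrongFunctional (κ : X → X → ℝ≥0∞) (A : Set X) (g : X → ℝ≥0∞) : Prop where
  ne_top : ∀ ν ∈ energyConeOn κ A, ∫⁻ x, g x ∂ν ≠ ⊤
  bound : ∃ B : ℝ, ∀ ν ∈ energyConeOn κ A, (∫⁻ x, g x ∂ν).toReal ^ 2 ≤ B * pairing κ ν ν
  continuous : ∀ (μ : ℕ → Measure X) (μ₀ : Measure X), (∀ j, μ j ∈ energyConeOn κ A) →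
    μ₀ ∈ energyConeOn κ A → StrongTendsto κ μ μ₀ →
    Tendsto (fun j => (∫⁻ x, g x ∂(μ j)).toReal) atTop (𝓝 (∫⁻ x, g x ∂μ₀).toReal)

/-- The Gauss functional `I(ν) - 2 ∫ g dν`. -/
noncomputable def gauss (κ : X → X → ℝ≥0∞) (g : X → ℝ≥0∞) (ν : Measure X) : ℝ :=
  pairing κ ν ν - 2 * (∫⁻ x, g x ∂ν).toReal

theorem StrongFunctional.toReal_lintegral_add_smul (hg : StrongFunctional κ A g)
    (hμ : μ ∈ energyConeOn κ A) (hν : ν ∈ energyConeOn κ A) (t : ℝ≥0) :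
    (∫⁻ x, g x ∂(μ + t • ν)).toReal = (∫⁻ x, g x ∂μ).toReal + t * (∫⁻ x, g x ∂ν).toReal := by
  rw [lintegral_add_measure, lintegral_smul_measure, ENNReal.smul_def, smul_eq_mul,
    ENNReal.toReal_add (hg.ne_top μ hμ) (ENNReal.mul_ne_top ENNReal.coe_ne_top (hg.ne_top ν hν)),
    ENNReal.toReal_mul, ENNReal.coe_toReal]

theorem StrongFunctional.toReal_lintegral_smul (t : ℝ≥0) :
    (∫⁻ x, g x ∂(t • ν)).toReal = t * (∫⁻ x, g x ∂ν).toReal := by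
  rw [lintegral_smul_measure, ENNReal.smul_def, smul_eq_mul, ENNReal.toReal_mul,
    ENNReal.coe_toReal]

theorem StrongFunctional.gauss_add_smul (hκ : AdmissibleKernel κ) (hg : StrongFunctional κ A g)
    (hμ : μ ∈ energyConeOn κ A) (hν : ν ∈ energyConeOn κ A) (t : ℝ≥0) :
    gauss κ g (μ + t • ν) = gauss κ g μ + 2 * t * (pairing κ μ ν - (∫⁻ x, g x ∂ν).toReal)
      + t ^ 2 * pairing κ ν ν := by
  have ht := hκ.smul_mem_energyCone t hν.1
  rw [gauss, gauss, hg.toReal_lintegral_add_smul hμ hν,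
    hκ.pairing_add_left hμ.1 ht (hκ.add_mem_energyCone hμ.1 ht),
    hκ.pairing_add_right hμ.1 ht hμ.1, hκ.pairing_add_right hμ.1 ht ht,
    hκ.pairing_smul_left t hν.1 hμ.1, hκ.pairing_smul_left t hν.1 ht,
    hκ.pairing_smul_right t hν.1 hμ.1, hκ.pairing_smul_right t hν.1 hν.1,
    hκ.pairing_comm hν.1 hμ.1]
  ring

theorem gauss_smul (hκ : AdmissibleKernel κ) (hν : ν ∈ energyCone κ) (t : ℝ≥0) :
    gauss κ g (t • ν) = t ^ 2 * pairing κ ν ν - 2 * t * (∫⁻ x, g x ∂ν).toReal := by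
  rw [gauss, StrongFunctional.toReal_lintegral_smul, hκ.pairing_smul_left t hν
    (hκ.smul_mem_energyCone t hν), hκ.pairing_smul_right t hν hν]
  ring

/-- From `L² ≤ |B| I(ν)` with `L = ∫ g dν`, the arithmetic–geometric mean inequality gives `2L ≤ |B|
+ I(ν)`. -/
theorem StrongFunctional.bddBelow_gauss (hg : StrongFunctional κ A g) :
    BddBelow (gauss κ g '' energyConeOn κ A) := by
  obtain ⟨B, hB⟩ := hg.bound
  refine ⟨-|B|, ?_⟩
  rintro _ ⟨ν, hν, rfl⟩
  have h := hB ν hν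
  have hp : 0 ≤ pairing κ ν ν := pairing_nonneg
  have h' : (∫⁻ x, g x ∂ν).toReal ^ 2 ≤ |B| * pairing κ ν ν :=
    h.trans (mul_le_mul_of_nonneg_right (le_abs_self B) hp)
  rw [gauss]
  have h3 : (2 * (∫⁻ x, g x ∂ν).toReal) ^ 2 ≤ (|B| + pairing κ ν ν) ^ 2 := by
    nlinarith [sq_nonneg (|B| - pairing κ ν ν)]
  have := abs_le_of_sq_le_sq h3 (by positivity)
  linarith [le_abs_self (2 * (∫⁻ x, g x ∂ν).toReal)]

/-- The Gauss functional attains its infimum over a strongly closed cone `ℰ⁺(A)`. -/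
theorem StrongFunctional.exists_isMinOn (hκ : AdmissibleKernel κ) (hA : StronglyClosedOn κ A)
    (hg : StrongFunctional κ A g) :
    ∃ P ∈ energyConeOn κ A, ∀ ν ∈ energyConeOn κ A, gauss κ g P ≤ gauss κ g ν := by
  set S := gauss κ g '' energyConeOn κ A with hS
  have hne : S.Nonempty := ⟨_, 0, zero_mem_energyConeOn, rfl⟩
  have hlow : ∀ ν ∈ energyConeOn κ A, sInf S ≤ gauss κ g ν := fun ν hν =>
    csInf_le hg.bddBelow_gauss ⟨ν, hν, rfl⟩
  obtain ⟨u, -, hu, huS⟩ := exists_seq_tendsto_sInf hne hg.bddBelow_gauss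
  choose ν hν hνu using huS
  -- Parallelogram identity, with the infimum tested at the midpoint of `ν i` and `ν j`.
  have hpar : ∀ i j, strongDistSq κ (ν i) (ν j) ≤ 2 * u i + 2 * u j - 4 * sInf S := by
    intro i j
    have h1 : (ν i) + (1 : ℝ≥0) • (ν j) ∈ energyConeOn κ A :=
      hκ.add_mem_energyConeOn (hν i) (hκ.smul_mem_energyConeOn 1 (hν j))
    have h := hlow _ (hκ.smul_mem_energyConeOn (1 / 2) h1)
    have e := hg.gauss_add_smul hκ (hν i) (hν j) 1
    rw [gauss_smul hκ h1.1, hg.toReal_lintegral_add_smul (hν i) (hν j)] at h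
    rw [gauss, gauss, hg.toReal_lintegral_add_smul (hν i) (hν j)] at e
    rw [← hνu, ← hνu, gauss, gauss, strongDistSq_eq]
    push_cast at h e
    linarith
  have hcauchy : StrongCauchy κ ν := by
    intro ε hε
    obtain ⟨N, hN⟩ := eventually_atTop.1
      (hu.eventually_lt_const (show sInf S < sInf S + ε / 4 by linarith))
    refine ⟨N, fun i hi j hj => (hpar i j).trans_lt ?_⟩
    linarith [hN i hi, hN j hj]
  obtain ⟨P, hP, hlim⟩ := hκ.consistency.1 ν (fun j => (hν j).1) hcauchy
  have hPA := hA ν P hν hP hlim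
  refine ⟨P, hPA, fun ρ hρ => le_trans ?_ (hlow ρ hρ)⟩
  have hpair : Tendsto (fun j => pairing κ (ν j) P) atTop (𝓝 (pairing κ P P)) := by
    have h0 : Tendsto (fun j => √(strongDistSq κ (ν j) P * pairing κ P P)) atTop (𝓝 0) := by
      have := (hlim.mul_const (pairing κ P P)).sqrt
      rwa [zero_mul, Real.sqrt_zero] at this
    rw [tendsto_iff_dist_tendsto_zero]
    refine squeeze_zero (fun _ => dist_nonneg) (fun j => ?_) h0
    rw [Real.dist_eq]
    exact Real.abs_le_sqrt (hκ.sq_pairing_sub_le (hν j).1 hP hP)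
  have hl := hg.continuous ν P hν hPA hlim
  -- Continuity of the energy itself is avoided: `I(ν j) ≥ 2 I(ν j, P) - I(P)`, and this lower bound
  -- converges to `I(P)`.
  have hlim2 := ((hpair.const_mul 2).sub_const (pairing κ P P)).sub (hl.const_mul 2)
  have hP2 : gauss κ g P
      = 2 * pairing κ P P - pairing κ P P - 2 * (∫⁻ x, g x ∂P).toReal := by rw [gauss]; ring
  rw [hP2]
  refine le_of_tendsto_of_tendsto hlim2 hu (Eventually.of_forall fun j => ?_)
  have := hκ.strongDistSq_nonneg (hν j).1 hP
  rw [strongDistSq_eq] at this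
  dsimp only
  rw [← hνu, gauss]
  linarith

theorem StrongFunctional.exists_variational (hκ : AdmissibleKernel κ) (hA : StronglyClosedOn κ A)
    (hg : StrongFunctional κ A g) :
    ∃ P ∈ energyConeOn κ A, (∀ ν ∈ energyConeOn κ A, ∫⁻ x, g x ∂ν ≤ mutualEnergy κ ν P) ∧
      ∫⁻ x, g x ∂P = mutualEnergy κ P P := by
  obtain ⟨P, hP, hmin⟩ := hg.exists_isMinOn hκ hA
  have hle : ∀ ν ∈ energyConeOn κ A, ∫⁻ x, g x ∂ν ≤ mutualEnergy κ ν P := by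
    intro ν hν
    rw [← ENNReal.toReal_le_toReal (hg.ne_top ν hν) (hκ.mutualEnergy_ne_top hν.1 hP.1)]
    change _ ≤ pairing κ ν P
    rw [hκ.pairing_comm hν.1 hP.1]
    by_contra! hlt
    set d := (∫⁻ x, g x ∂ν).toReal - pairing κ P ν with hd
    have hd0 : 0 < d := by linarith
    have hp : 0 ≤ pairing κ ν ν := pairing_nonneg
    -- So small a `t` that `t I(ν) < d`: the linear decrease `2td` then beats the quadratic increase
    -- `t² I(ν)`.
    obtain ⟨t, ht⟩ : ∃ t : ℝ≥0, (t : ℝ) = d / (pairing κ ν ν + 1) :=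
      ⟨_, Real.coe_toNNReal _ (by positivity)⟩
    have h := hmin _ (hκ.add_mem_energyConeOn hP (hκ.smul_mem_energyConeOn t hν))
    rw [hg.gauss_add_smul hκ hP hν] at h
    have ht0 : 0 < (t : ℝ) := by rw [ht]; positivity
    have htd : t * (pairing κ ν ν + 1) = d := by rw [ht]; field_simp
    have : 0 ≤ (t : ℝ) * (t * pairing κ ν ν - 2 * d) := by rw [hd]; linarith
    have := nonneg_of_mul_nonneg_right this ht0
    nlinarith
  refine ⟨P, hP, hle, le_antisymm (hle P hP) ?_⟩
  rw [← ENNReal.toReal_le_toReal (hκ.mutualEnergy_ne_top hP.1 hP.1) (hg.ne_top P hP)]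
  change pairing κ P P ≤ _
  by_contra! hlt
  set l := (∫⁻ x, g x ∂P).toReal with hl
  have hl0 : 0 ≤ l := ENNReal.toReal_nonneg
  have hp : 0 < pairing κ P P := hl0.trans_lt hlt
  -- The minimum point of the quadratic `t ↦ t² I(P) - 2tl` on the ray through `P`.
  obtain ⟨t, ht⟩ : ∃ t : ℝ≥0, (t : ℝ) = l / pairing κ P P :=
    ⟨_, Real.coe_toNNReal _ (by positivity)⟩
  have h := hmin _ (hκ.smul_mem_energyConeOn t hP)
  rw [gauss_smul hκ hP.1, gauss, ← hl, ht] at h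
  have e : (l / pairing κ P P) ^ 2 * pairing κ P P - 2 * (l / pairing κ P P) * l
      = - (l ^ 2 / pairing κ P P) := by field_simp; norm_num
  rw [e] at h
  have : (pairing κ P P - l) ^ 2 / pairing κ P P ≤ 0 := by
    have : (pairing κ P P - l) ^ 2 / pairing κ P P
      = pairing κ P P - 2 * l + l ^ 2 / pairing κ P P := by field_simp; ring
    linarith
  have h2 : 0 < (pairing κ P P - l) ^ 2 / pairing κ P P :=
    div_pos (pow_pos (sub_pos.2 hlt) 2) hp
  linarith

/-- Solution of the Gauss variational problem: its potential dominates `g` and agrees with `g`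
almost everywhere with respect to the solution. -/
theorem StrongFunctional.exists_potential (hκ : AdmissibleKernel κ) (hA : StronglyClosedOn κ A)
    (hgm : Measurable g) (hg : StrongFunctional κ A g) :
    ∃ P ∈ energyConeOn κ A, (∀ ν ∈ energyConeOn κ A, ∀ᵐ x ∂ν, g x ≤ potential κ P x) ∧
      ∀ᵐ x ∂P, potential κ P x = g x := by
  obtain ⟨P, hP, hle, heq⟩ := hg.exists_variational hκ hA
  have hU := hκ.measurable_potential hP.1.1
  have hdom : ∀ ν ∈ energyConeOn κ A, ∀ᵐ x ∂ν, g x ≤ potential κ P x := by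
    intro ν hν
    have hS : MeasurableSet {x | potential κ P x < g x} := measurableSet_lt hU hgm
    -- The integrated inequality becomes pointwise by testing it on the part of `ν` where it is
    -- supposed to fail.
    have hν' := hκ.mem_energyConeOn_of_le hν
      (Measure.restrict_le_self (μ := ν) (s := {x | potential κ P x < g x}))
    have h := hle _ hν'
    rw [hκ.mutualEnergy_eq hν'.1.1 hP.1.1] at h
    have hae : ∀ᵐ x ∂ν.restrict {x | potential κ P x < g x}, potential κ P x < g x :=
      ae_restrict_mem hS
    have hfin : ∫⁻ x, potential κ P x ∂ν.restrict {x | potential κ P x < g x} ≠ ⊤ := by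
      rw [← hκ.mutualEnergy_eq hν'.1.1 hP.1.1]
      exact hκ.mutualEnergy_ne_top hν'.1 hP.1
    have heq' := ae_eq_of_ae_le_of_lintegral_le (hae.mono fun x hx => hx.le) hfin
      hgm.aemeasurable h
    have hF : ∀ᵐ x ∂ν.restrict {x | potential κ P x < g x}, False := by
      filter_upwards [hae, heq'] with x h1 h2 using h1.ne h2
    rw [ae_iff] at hF ⊢
    simpa using hF
  refine ⟨P, hP, hdom, ?_⟩
  rw [hκ.mutualEnergy_eq hP.1.1 hP.1.1] at heq
  have := ae_eq_of_ae_le_of_lintegral_le (hdom P hP) (hg.ne_top P hP) hU.aemeasurable heq.ge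
  exact this.symm

/-! ### Compact sets, equilibrium measures and positivity of mass. -/

theorem mem_ae_of_mem_energyConeOn (hμ : μ ∈ energyConeOn κ A) : ∀ᵐ x ∂μ, x ∈ A :=
  mem_ae_iff.2 hμ.2

theorem measure_univ_ne_top_of_isCompact (hK : IsCompact K) (hμ : μ ∈ energyConeOn κ K) :
    μ Set.univ ≠ ⊤ := by
  have : IsLocallyFiniteMeasure μ := hμ.1.1
  rw [← Set.union_compl_self K]
  refine ((measure_union_le _ _).trans_lt ?_).ne
  rw [hμ.2, add_zero]
  exact hK.measure_lt_top

/-- Strong convergence implies vague convergence, and a bump function that vanishes on `K` detects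
any mass of the limit off `K`. -/
theorem AdmissibleKernel.stronglyClosedOn_of_isCompact (hκ : AdmissibleKernel κ)
    (hK : IsCompact K) : StronglyClosedOn κ K := by
  intro μ μ₀ hμ hμ₀ hlim
  have : IsLocallyFiniteMeasure μ₀ := hμ₀.1
  refine ⟨hμ₀, ?_⟩
  by_contra hne
  obtain ⟨L, hLK, hL, hL0⟩ := exists_isCompact_measure_ne_zero hμ₀.1 hK.measurableSet.compl hne
  obtain ⟨f, hf1, hf0, hfc, hf⟩ := exists_continuous_one_zero_of_isCompact hL hK.isClosed
    (Set.disjoint_left.2 fun x hx hxK => hLK hx hxK)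
  have hv := hκ.consistency.2 μ μ₀ (fun j => (hμ j).1) hμ₀ hlim f f.continuous hfc
  have hz : ∀ j, ∫ x, f x ∂(μ j) = 0 := fun j => integral_eq_zero_of_ae <|
    (mem_ae_of_mem_energyConeOn (hμ j)).mono fun x hx => hf0 hx
  simp only [hz] at hv
  have h0 := tendsto_nhds_unique hv tendsto_const_nhds
  rw [integral_eq_zero_iff_of_nonneg (fun x => (hf x).1)
    (f.continuous.integrable_of_hasCompactSupport hfc)] at h0
  refine hL0 (measure_mono_null (fun x hx => ?_) (ae_iff.1 h0))
  change ¬ f x = 0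
  rw [hf1 hx]
  exact one_ne_zero

/-- A compact set has finite capacity. -/
theorem AdmissibleKernel.exists_mass_bound (hκ : AdmissibleKernel κ) (hK : IsCompact K) :
    ∃ B : ℝ, ∀ ν ∈ energyConeOn κ K, (ν Set.univ).toReal ^ 2 ≤ B * pairing κ ν ν := by
  by_contra! hc
  choose ν hν hlt using fun n : ℕ => hc n
  have hpos : ∀ n, 0 < (ν n Set.univ).toReal := by
    intro n
    refine lt_of_le_of_ne ENNReal.toReal_nonneg fun h => ?_
    have := hlt n
    rw [← h] at this
    have hp : 0 ≤ pairing κ (ν n) (ν n) := pairing_nonneg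
    have : (0 : ℝ) ≤ n * pairing κ (ν n) (ν n) := by positivity
    linarith
  have hc' : ∀ n, ∃ t : ℝ≥0, (t : ℝ) = (ν n Set.univ).toReal⁻¹ := fun n =>
    ⟨_, Real.coe_toNNReal _ (inv_pos.2 (hpos n)).le⟩
  choose c hcn using hc'
  have hm : ∀ n, c n • ν n ∈ energyConeOn κ K := fun n => hκ.smul_mem_energyConeOn _ (hν n)
  have hE : ∀ n : ℕ, (n : ℝ) * pairing κ (c n • ν n) (c n • ν n) ≤ 1 := by
    intro n
    rw [hκ.pairing_smul_left _ (hν n).1 (hm n).1, hκ.pairing_smul_right _ (hν n).1 (hν n).1, hcn]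
    have := hpos n
    have := (hlt n).le
    field_simp
    linarith
  -- After normalisation to unit mass the energies are at most `1/n`. The strong limit is then zero,
  -- while a compactly supported function equal to `1` on `K` always integrates to `1`.
  have hlim : StrongTendsto κ (fun n => c n • ν n) 0 := by
    have he : ∀ n, strongDistSq κ (c n • ν n) 0 = pairing κ (c n • ν n) (c n • ν n) := by
      intro n
      simp [strongDistSq, pairing, mutualEnergy, energy]
    rw [StrongTendsto]
    simp only [he]
    refine squeeze_zero' (Eventually.of_forall fun _ => pairing_nonneg) ?_
      tendsto_one_div_atTop_nhds_zero_nat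
    filter_upwards [eventually_gt_atTop 0] with n hn
    have hn' : (0 : ℝ) < n := Nat.cast_pos.2 hn
    rw [le_div_iff₀ hn']
    linarith [hE n]
  obtain ⟨f, hf1, -, hfc, -⟩ := exists_continuous_one_zero_of_isCompact hK isClosed_empty
    (Set.disjoint_empty K)
  have hv := hκ.consistency.2 _ 0 (fun j => (hm j).1) zero_mem_energyCone hlim f f.continuous hfc
  have h1 : ∀ n, ∫ x, f x ∂(c n • ν n) = 1 := by
    intro n
    have : ∫ x, f x ∂(ν n) = (ν n Set.univ).toReal := by
      have h : f =ᵐ[ν n] fun _ => (1 : ℝ) :=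
        (mem_ae_of_mem_energyConeOn (hν n)).mono fun x hx => hf1 hx
      rw [integral_congr_ae h]
      simp [Measure.real]
    rw [integral_smul_nnreal_measure, this, NNReal.smul_def, hcn, smul_eq_mul,
      inv_mul_cancel₀ (hpos n).ne']
  simp only [h1, integral_zero_measure] at hv
  exact one_ne_zero (tendsto_nhds_unique tendsto_const_nhds hv)

/-- Integration of a function that is continuous on a compact set `K` is a strongly continuous
functional on `ℰ⁺(K)`. -/
theorem AdmissibleKernel.strongFunctional_of_isCompact (hκ : AdmissibleKernel κ)
    (hK : IsCompact K) (hgm : Measurable g) (hgc : ContinuousOn g K) {m : ℝ≥0}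
    (hm : ∀ x ∈ K, g x ≤ m) : StrongFunctional κ K g := by
  have hbd : ∀ ν ∈ energyConeOn κ K, ∫⁻ x, g x ∂ν ≤ m * ν Set.univ := fun ν hν => by
    rw [← lintegral_const]
    exact lintegral_mono_ae ((mem_ae_of_mem_energyConeOn hν).mono hm)
  have hfin : ∀ ν ∈ energyConeOn κ K, (m : ℝ≥0∞) * ν Set.univ ≠ ⊤ := fun ν hν =>
    ENNReal.mul_ne_top ENNReal.coe_ne_top (measure_univ_ne_top_of_isCompact hK hν)
  refine ⟨fun ν hν => ((hbd ν hν).trans_lt (hfin ν hν).lt_top).ne, ?_, ?_⟩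
  · obtain ⟨B, hB⟩ := hκ.exists_mass_bound hK
    refine ⟨m ^ 2 * B, fun ν hν => ?_⟩
    have h := ENNReal.toReal_mono (hfin ν hν) (hbd ν hν)
    rw [ENNReal.toReal_mul, ENNReal.coe_toReal] at h
    calc (∫⁻ x, g x ∂ν).toReal ^ 2 ≤ (m * (ν Set.univ).toReal) ^ 2 :=
          pow_le_pow_left₀ ENNReal.toReal_nonneg h 2
      _ = m ^ 2 * (ν Set.univ).toReal ^ 2 := by ring
      _ ≤ m ^ 2 * (B * pairing κ ν ν) := by gcongr; exact hB ν hν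
      _ = m ^ 2 * B * pairing κ ν ν := by ring
  · intro μ μ₀ hμ hμ₀ hlim
    have hlt : ∀ x ∈ K, g x < ⊤ := fun x hx => (hm x hx).trans_lt ENNReal.coe_lt_top
    have hc : ContinuousOn (fun x => (g x).toReal) K :=
      ENNReal.continuousOn_toReal.comp hgc fun x hx => (hlt x hx).ne
    -- A Tietze extension times a cutoff equal to `1` on `K` replaces `g` by a compactly supported
    -- continuous function, to which vague convergence applies.
    obtain ⟨G, hG⟩ := ContinuousMap.exists_restrict_eq hK.isClosed
      (⟨_, continuousOn_iff_continuous_domRestrict.1 hc⟩ : C(K, ℝ))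
    obtain ⟨f, hf1, -, hfc, -⟩ := exists_continuous_one_zero_of_isCompact hK isClosed_empty
      (Set.disjoint_empty K)
    have hGK : ∀ x ∈ K, G x * f x = (g x).toReal := by
      intro x hx
      have h1 := DFunLike.congr_fun hG (⟨x, hx⟩ : K)
      have h2 : f x = 1 := hf1 hx
      rw [h2, mul_one]
      exact h1
    have hint : ∀ ν ∈ energyConeOn κ K, (∫⁻ x, g x ∂ν).toReal = ∫ x, G x * f x ∂ν := by
      intro ν hν
      have hae := mem_ae_of_mem_energyConeOn hν
      rw [← integral_toReal hgm.aemeasurable (hae.mono hlt)]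
      exact integral_congr_ae (hae.mono fun x hx => (hGK x hx).symm)
    rw [hint μ₀ hμ₀]
    simp only [fun j => hint (μ j) (hμ j)]
    exact hκ.consistency.2 μ μ₀ (fun j => (hμ j).1) hμ₀.1 hlim _ (G.continuous.mul f.continuous)
      hfc.mul_left

/-- The inner equilibrium measure of a compact set. -/
theorem AdmissibleKernel.exists_equilibrium (hκ : AdmissibleKernel κ) (hF : FrostmanPrinciple κ)
    (hK : IsCompact K) : ∃ γ ∈ energyConeOn κ K,
      (∀ ν ∈ energyConeOn κ K, ∀ᵐ x ∂ν, 1 ≤ potential κ γ x) ∧ ∀ x, potential κ γ x ≤ 1 := by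
  obtain ⟨γ, hγ, h1, h2⟩ := (hκ.strongFunctional_of_isCompact (g := fun _ => 1) (m := 1) hK
    measurable_const continuousOn_const fun _ _ => by simp).exists_potential hκ
      (hκ.stronglyClosedOn_of_isCompact hK) measurable_const
  refine ⟨γ, hγ, h1, fun x => ?_⟩
  have := hF γ hγ.1 1 one_pos (h2.mono fun x hx => by simp [hx]) x
  simpa using this

/-- The principle of positivity of mass, for measures concentrated on `A`. -/
theorem AdmissibleKernel.measure_univ_le (hκ : AdmissibleKernel κ) (hF : FrostmanPrinciple κ)
    (hμ : μ ∈ energyConeOn κ A) (hν : ν ∈ radonPos X)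
    (h : ∀ σ ∈ energyConeOn κ A, ∀ᵐ x ∂σ, potential κ μ x ≤ potential κ ν x) :
    μ Set.univ ≤ ν Set.univ := by
  have : IsLocallyFiniteMeasure μ := hμ.1.1
  have h0 : μ (toMeasurable μ Aᶜ) = 0 := (measure_toMeasurable _).trans hμ.2
  have hmeas := (measurableSet_toMeasurable μ Aᶜ).compl
  have huniv : μ Set.univ = μ (toMeasurable μ Aᶜ)ᶜ := by
    rw [Set.compl_eq_univ_sdiff, measure_sdiff_null h0]
  rw [huniv, hmeas.measure_eq_iSup_isCompact μ]
  refine iSup_le fun K => iSup_le fun hKA => iSup_le fun hK => ?_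
  have hKA' : K ⊆ A := fun x hx => by
    by_contra hxA
    exact hKA hx (subset_toMeasurable _ _ hxA)
  obtain ⟨γ, hγ, h1, h2⟩ := hκ.exists_equilibrium hF hK
  have hμK : μ.restrict K ∈ energyConeOn κ K :=
    ⟨hκ.mem_energyCone_of_le hμ.1 Measure.restrict_le_self, by
      rw [Measure.restrict_apply hK.measurableSet.compl, Set.compl_inter_self, measure_empty]⟩
  -- Symmetry of the mutual energy is used twice, to move the integration from `μ` to `γ` and from
  -- `γ` to `ν`.
  calc μ K = ∫⁻ _, 1 ∂μ.restrict K := by simp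
    _ ≤ ∫⁻ x, potential κ γ x ∂μ.restrict K := lintegral_mono_ae (h1 _ hμK)
    _ ≤ ∫⁻ x, potential κ γ x ∂μ := lintegral_mono' Measure.restrict_le_self le_rfl
    _ = mutualEnergy κ μ γ := (hκ.mutualEnergy_eq hμ.1.1 hγ.1.1).symm
    _ = mutualEnergy κ γ μ := hκ.mutualEnergy_comm hμ.1.1 hγ.1.1
    _ = ∫⁻ x, potential κ μ x ∂γ := hκ.mutualEnergy_eq hγ.1.1 hμ.1.1
    _ ≤ ∫⁻ x, potential κ ν x ∂γ := lintegral_mono_ae (h γ (energyConeOn_mono hKA' hγ))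
    _ = mutualEnergy κ γ ν := (hκ.mutualEnergy_eq hγ.1.1 hν).symm
    _ = mutualEnergy κ ν γ := hκ.mutualEnergy_comm hγ.1.1 hν
    _ = ∫⁻ x, potential κ γ x ∂ν := hκ.mutualEnergy_eq hν hγ.1.1
    _ ≤ ∫⁻ _, 1 ∂ν := lintegral_mono h2
    _ = ν Set.univ := by simp

/-! ### Strong continuity of integration against `U^ω`, and sweeping. -/

/-- Fatou's lemma along the neighbourhood filter. Together with the assumed upper semicontinuity it
makes `U^ω` continuous on compact subsets of `A`. -/
theorem lowerSemicontinuous_potential (hκ : AdmissibleKernel κ) :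
    LowerSemicontinuous (potential κ μ) := by
  rw [lowerSemicontinuous_iff_le_liminf]
  intro x
  have hsec : ∀ y, κ x y ≤ liminf (fun z => κ z y) (𝓝 x) := fun y =>
    (hκ.lsc.comp (by fun_prop : Continuous fun z => (z, y))).le_liminf x
  calc potential κ μ x ≤ ∫⁻ y, liminf (fun z => κ z y) (𝓝 x) ∂μ := lintegral_mono hsec
    _ ≤ liminf (fun z => ∫⁻ y, κ z y ∂μ) (𝓝 x) :=
        lintegral_liminf_le fun z => hκ.measurable.of_uncurry_left

theorem strongFunctional_of_lipschitz (hfin : ∀ ν ∈ energyConeOn κ A, ∫⁻ x, g x ∂ν ≠ ⊤) (B : ℝ)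
    (hB : ∀ ν ∈ energyConeOn κ A, ∀ ρ ∈ energyConeOn κ A,
      ((∫⁻ x, g x ∂ν).toReal - (∫⁻ x, g x ∂ρ).toReal) ^ 2 ≤ B * strongDistSq κ ν ρ) :
    StrongFunctional κ A g := by
  refine ⟨hfin, ⟨B, fun ν hν => ?_⟩, fun μ μ₀ hμ hμ₀ hlim => ?_⟩
  · have h := hB ν hν 0 zero_mem_energyConeOn
    simpa [strongDistSq_eq, pairing, mutualEnergy] using h
  · have h0 : Tendsto (fun j => √(B * strongDistSq κ (μ j) μ₀)) atTop (𝓝 0) := by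
      have := (hlim.const_mul B).sqrt
      rwa [mul_zero, Real.sqrt_zero] at this
    rw [tendsto_iff_dist_tendsto_zero]
    refine squeeze_zero (fun _ => dist_nonneg) (fun j => ?_) h0
    rw [Real.dist_eq]
    exact Real.abs_le_sqrt (hB _ (hμ j) _ hμ₀)

theorem AdmissibleKernel.strongFunctional_of_mem_energyCone (hκ : AdmissibleKernel κ)
    (hω : ω ∈ energyCone κ) : StrongFunctional κ A (potential κ ω) := by
  refine strongFunctional_of_lipschitz (fun ν hν => ?_) (pairing κ ω ω) fun ν hν ρ hρ => ?_
  · rw [← hκ.mutualEnergy_eq hν.1.1 hω.1]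
    exact hκ.mutualEnergy_ne_top hν.1 hω
  · rw [← hκ.mutualEnergy_eq hν.1.1 hω.1, ← hκ.mutualEnergy_eq hρ.1.1 hω.1, mul_comm]
    exact hκ.sq_pairing_sub_le hν.1 hρ.1 hω

/-- If the potential of `ω` is a strongly continuous functional on `ℰ⁺(A)`, then there is a measure
in `ℰ⁺(A)` whose potential is at most `U^ω`, with equality almost everywhere with respect to every
measure in `ℰ⁺(A)`. -/
theorem AdmissibleKernel.exists_swept (hκ : AdmissibleKernel κ) (hA : StronglyClosedOn κ A)
    (hω : ω ∈ radonPos X) (hg : StrongFunctional κ A (potential κ ω)) :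
    ∃ P ∈ energyConeOn κ A, (∀ x, potential κ P x ≤ potential κ ω x) ∧
      ∀ ν ∈ energyConeOn κ A, ∀ᵐ x ∂ν, potential κ P x = potential κ ω x := by
  obtain ⟨P, hP, h1, h2⟩ := hg.exists_potential hκ hA (hκ.measurable_potential hω)
  have hle := hκ.domination P hP.1 ω hω (h2.mono fun x hx => hx.le)
  exact ⟨P, hP, hle, fun ν hν => (h1 ν hν).mono fun x hx => (hle x).antisymm hx⟩

/-- A measure concentrated on `A` is concentrated on a countable increasing union of compact subsets
of `A`. -/
theorem exists_compact_exhaustion (hρ : ρ ∈ radonPos X) (h : ρ Aᶜ = 0) :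
    ∃ K : ℕ → Set X, Monotone K ∧ (∀ n, IsCompact (K n)) ∧ (∀ n, K n ⊆ A) ∧
      ρ (⋃ n, K n)ᶜ = 0 := by
  have : IsLocallyFiniteMeasure ρ := hρ
  -- An equivalent finite measure, so that a set of possibly infinite `ρ`-measure can be
  -- approximated from inside by compact sets up to small error.
  obtain ⟨τ, hτ, hρτ, hτρ⟩ := exists_isFiniteMeasure_absolutelyContinuous ρ
  have h0 : τ (toMeasurable τ Aᶜ) = 0 := (measure_toMeasurable _).trans (hτρ h)
  have hmeas := (measurableSet_toMeasurable τ Aᶜ).compl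
  have hsub : (toMeasurable τ Aᶜ)ᶜ ⊆ A := fun x hx => by
    by_contra hxA
    exact hx (subset_toMeasurable _ _ hxA)
  have hL : ∀ n : ℕ, ∃ L ⊆ (toMeasurable τ Aᶜ)ᶜ, IsCompact L ∧
      τ ((toMeasurable τ Aᶜ)ᶜ \ L) < ((n : ℝ≥0∞) + 1)⁻¹ := fun n =>
    hmeas.exists_isCompact_sdiff_lt (measure_ne_top _ _) (by simp)
  choose L hLs hLc hLt using hL
  refine ⟨fun n => ⋃ i ∈ Set.Iic n, L i, ?_, fun n => ?_, fun n => ?_, hρτ ?_⟩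
  · exact fun m n hmn => Set.biUnion_subset_biUnion_left (Set.Iic_subset_Iic.2 hmn)
  · exact (Set.finite_Iic n).isCompact_biUnion fun i _ => hLc i
  · exact Set.iUnion₂_subset fun i _ => (hLs i).trans hsub
  · have hb : ∀ n : ℕ, τ (⋃ n, ⋃ i ∈ Set.Iic n, L i)ᶜ ≤ ((n : ℝ≥0∞) + 1)⁻¹ := by
      intro n
      have hss : (⋃ n, ⋃ i ∈ Set.Iic n, L i)ᶜ ⊆
          toMeasurable τ Aᶜ ∪ ((toMeasurable τ Aᶜ)ᶜ \ L n) := by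
        intro x hx
        by_cases hxT : x ∈ toMeasurable τ Aᶜ
        · exact Or.inl hxT
        · refine Or.inr ⟨hxT, fun hxL => hx ?_⟩
          exact Set.mem_iUnion.2 ⟨n, Set.mem_iUnion₂.2 ⟨n, Set.self_mem_Iic, hxL⟩⟩
      calc _ ≤ _ := measure_mono hss
        _ ≤ _ := measure_union_le _ _
        _ ≤ _ := by rw [h0, zero_add]; exact (hLt n).le
    have h1 : Tendsto (fun n : ℕ => ((n : ℝ≥0∞) + 1)⁻¹) atTop (𝓝 0) := by
      simpa using (tendsto_add_atTop_iff_nat 1).2 ENNReal.tendsto_inv_nat_nhds_zero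
    exact le_antisymm (ge_of_tendsto' h1 hb) zero_le

theorem restrict_eq_self_of_compl_eq_zero {S : Set X} (h : μ Sᶜ = 0) : μ.restrict S = μ :=
  Measure.restrict_eq_self_of_ae_mem (mem_ae_iff.2 h)

theorem tendsto_setLIntegral_of_monotone {Y : Type*} [MeasurableSpace Y] {τ : Measure Y}
    {S : ℕ → Set Y} (hS : Monotone S) (f : Y → ℝ≥0∞) :
    Tendsto (fun n => ∫⁻ x in S n, f x ∂τ) atTop (𝓝 (∫⁻ x in ⋃ n, S n, f x ∂τ)) := by
  rw [setLIntegral_iUnion_of_directed f hS.directed_le]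
  exact tendsto_atTop_iSup fun m n hmn => lintegral_mono_set (hS hmn)

theorem tendsto_mutualEnergy_restrict (hμ : μ ∈ radonPos X) (hν : ν ∈ radonPos X)
    {K : ℕ → Set X} (hK : Monotone K) (hμK : μ (⋃ n, K n)ᶜ = 0) (hνK : ν (⋃ n, K n)ᶜ = 0) :
    Tendsto (fun n => mutualEnergy κ (μ.restrict (K n)) (ν.restrict (K n))) atTop
      (𝓝 (mutualEnergy κ μ ν)) := by
  have : IsLocallyFiniteMeasure μ := hμ
  have : IsLocallyFiniteMeasure ν := hν
  have hU : ⋃ n, K n ×ˢ K n = (⋃ n, K n) ×ˢ (⋃ n, K n) :=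
    Set.iUnion_prod_of_monotone hK hK
  have h := tendsto_setLIntegral_of_monotone (τ := μ.prod ν) (S := fun n => K n ×ˢ K n)
    (fun m n hmn => Set.prod_mono (hK hmn) (hK hmn)) fun p => κ p.1 p.2
  rw [hU, ← Measure.prod_restrict, restrict_eq_self_of_compl_eq_zero hμK,
    restrict_eq_self_of_compl_eq_zero hνK] at h
  simp only [← Measure.prod_restrict] at h
  exact h

theorem restrict_mem_energyConeOn (hκ : AdmissibleKernel κ) (hμ : μ ∈ energyCone κ)
    (hK : IsCompact K) : μ.restrict K ∈ energyConeOn κ K :=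
  ⟨hκ.mem_energyCone_of_le hμ Measure.restrict_le_self, by
    rw [Measure.restrict_apply hK.measurableSet.compl, Set.compl_inter_self, measure_empty]⟩

/-- Balayage onto compact subsets of `A` of a bounded measure whose potential is bounded on `A` and
continuous on the compact subsets of `A`, with a uniform bound on the energy. -/
theorem AdmissibleKernel.exists_swept_isCompact (hκ : AdmissibleKernel κ)
    (hF : FrostmanPrinciple κ) (hω : ω ∈ radonPos X) (hK : IsCompact K)
    (husc : UpperSemicontinuousOn (potential κ ω) K) {m : ℝ≥0}
    (hm : ∀ x ∈ K, potential κ ω x ≤ m) :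
    ∃ P ∈ energyConeOn κ K, energy κ P ≤ m * ω Set.univ ∧
      ∀ ν ∈ energyConeOn κ K, ∫⁻ x, potential κ ω x ∂ν = mutualEnergy κ ν P := by
  have hcont : ContinuousOn (potential κ ω) K := continuousOn_iff_lower_upperSemicontinuousOn.2
    ⟨(lowerSemicontinuous_potential hκ).lowerSemicontinuousOn K, husc⟩
  obtain ⟨P, hP, h1, h2⟩ := hκ.exists_swept (hκ.stronglyClosedOn_of_isCompact hK) hω
    (hκ.strongFunctional_of_isCompact hK (hκ.measurable_potential hω) hcont hm)
  refine ⟨P, hP, ?_, fun ν hν => ?_⟩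
  -- Positivity of mass gives `P(X) ≤ ω(X)`, so the bound does not depend on `K`.
  · calc energy κ P = ∫⁻ x, potential κ P x ∂P := hκ.mutualEnergy_eq hP.1.1 hP.1.1
      _ ≤ ∫⁻ _, m ∂P := lintegral_mono_ae ((mem_ae_of_mem_energyConeOn hP).mono fun x hx =>
          (h1 x).trans (hm x hx))
      _ = m * P Set.univ := lintegral_const _
      _ ≤ m * ω Set.univ := mul_le_mul' le_rfl
          (hκ.measure_univ_le hF hP hω fun σ _ => Eventually.of_forall h1)
  · rw [hκ.mutualEnergy_eq hν.1.1 hP.1.1]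
    exact lintegral_congr_ae ((h2 ν hν).mono fun x hx => hx.symm)

/-- On compact `K ⊆ A` the functional is the pairing with a measure of energy at most `m ω(X)`, so
Cauchy–Schwarz makes it Lipschitz with a constant independent of `K`. Exhausting `A` up to null sets
carries the estimate over to all of `ℰ⁺(A)`. -/
theorem AdmissibleKernel.strongFunctional_of_bounded (hκ : AdmissibleKernel κ)
    (hF : FrostmanPrinciple κ) (hω : ω ∈ radonPos X) (hfin : ω Set.univ < ⊤)
    (husc : ∀ K : Set X, IsCompact K → K ⊆ A → UpperSemicontinuousOn (potential κ ω) K) {m : ℝ≥0}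
    (hm : ∀ x ∈ A, potential κ ω x ≤ m) : StrongFunctional κ A (potential κ ω) := by
  have hB : (m : ℝ≥0∞) * ω Set.univ ≠ ⊤ := ENNReal.mul_ne_top ENNReal.coe_ne_top hfin.ne
  have hcpt := fun K (hK : IsCompact K) (hKA : K ⊆ A) =>
    hκ.exists_swept_isCompact hF hω hK (husc K hK hKA) fun x hx => hm x (hKA hx)
  have hlim : ∀ (ν : Measure X) (K : ℕ → Set X), Monotone K → ν (⋃ n, K n)ᶜ = 0 →
      Tendsto (fun n => ∫⁻ x in K n, potential κ ω x ∂ν) atTop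
        (𝓝 (∫⁻ x, potential κ ω x ∂ν)) := by
    intro ν K hK hνK
    have h := tendsto_setLIntegral_of_monotone (τ := ν) hK (potential κ ω)
    rwa [restrict_eq_self_of_compl_eq_zero hνK] at h
  have hne : ∀ ν ∈ energyConeOn κ A, ∫⁻ x, potential κ ω x ∂ν ≠ ⊤ := by
    intro ν hν
    obtain ⟨K, hKm, hK, hKA, hK0⟩ := exists_compact_exhaustion hν.1.1 hν.2
    refine ((le_of_tendsto' (hlim ν K hKm hK0) fun n => ?_).trans_lt
      (ENNReal.add_lt_top.2 ⟨hν.1.2, hB.lt_top⟩)).ne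
    obtain ⟨P, hP, hPE, hPν⟩ := hcpt (K n) (hK n) (hKA n)
    have hr := restrict_mem_energyConeOn hκ hν.1 (hK n)
    rw [hPν _ hr]
    calc mutualEnergy κ (ν.restrict (K n)) P ≤ 2 * mutualEnergy κ (ν.restrict (K n)) P :=
          le_mul_of_one_le_left' one_le_two
      _ ≤ energy κ (ν.restrict (K n)) + energy κ P :=
          (hκ.energy_principle _ hr.1.1 P hP.1.1).1
      _ ≤ energy κ ν + m * ω Set.univ := by
          refine add_le_add ?_ hPE
          rw [energy, energy]
          calc _ ≤ mutualEnergy κ ν (ν.restrict (K n)) :=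
                hκ.mutualEnergy_mono_left hν.1.1 hr.1.1 Measure.restrict_le_self
            _ = mutualEnergy κ (ν.restrict (K n)) ν := hκ.mutualEnergy_comm hν.1.1 hr.1.1
            _ ≤ mutualEnergy κ ν ν :=
                hκ.mutualEnergy_mono_left hν.1.1 hν.1.1 Measure.restrict_le_self
  refine strongFunctional_of_lipschitz hne (m * ω Set.univ).toReal fun ν hν ρ hρ => ?_
  -- An exhaustion for `ν + ρ` serves both measures at once.
  obtain ⟨K, hKm, hK, hKA, hK0⟩ := exists_compact_exhaustion
    (add_mem_radonPos hν.1.1 hρ.1.1) (hκ.add_mem_energyConeOn hν hρ).2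
  rw [Measure.add_apply, add_eq_zero] at hK0
  have hpair : ∀ σ ∈ energyCone κ, ∀ τ ∈ energyCone κ, σ (⋃ n, K n)ᶜ = 0 → τ (⋃ n, K n)ᶜ = 0 →
      Tendsto (fun n => pairing κ (σ.restrict (K n)) (τ.restrict (K n))) atTop
        (𝓝 (pairing κ σ τ)) := fun σ hσ τ hτ hσ0 hτ0 =>
    (ENNReal.tendsto_toReal (hκ.mutualEnergy_ne_top hσ hτ)).comp
      (tendsto_mutualEnergy_restrict hσ.1 hτ.1 hKm hσ0 hτ0)
  have hd : Tendsto (fun n => strongDistSq κ (ν.restrict (K n)) (ρ.restrict (K n))) atTop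
      (𝓝 (strongDistSq κ ν ρ)) :=
    ((hpair ν hν.1 ν hν.1 hK0.1 hK0.1).sub ((hpair ν hν.1 ρ hρ.1 hK0.1 hK0.2).const_mul 2)).add
      (hpair ρ hρ.1 ρ hρ.1 hK0.2 hK0.2)
  have h1 := (ENNReal.tendsto_toReal (hne ν hν)).comp (hlim ν K hKm hK0.1)
  have h2 := (ENNReal.tendsto_toReal (hne ρ hρ)).comp (hlim ρ K hKm hK0.2)
  refine le_of_tendsto_of_tendsto' ((h1.sub h2).pow 2) (hd.const_mul _) fun n => ?_
  obtain ⟨P, hP, hPE, hPν⟩ := hcpt (K n) (hK n) (hKA n)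
  have hrν := restrict_mem_energyConeOn hκ hν.1 (hK n)
  have hrρ := restrict_mem_energyConeOn hκ hρ.1 (hK n)
  dsimp only [Function.comp]
  rw [hPν _ hrν, hPν _ hrρ, mul_comm]
  refine (hκ.sq_pairing_sub_le hrν.1 hrρ.1 hP.1).trans ?_
  exact mul_le_mul_of_nonneg_left (ENNReal.toReal_mono hB hPE)
    (hκ.strongDistSq_nonneg hrν.1 hrρ.1)

theorem AdmissibleMeasure.strongFunctional (hκ : AdmissibleKernel κ) (hF : FrostmanPrinciple κ)
    (hω : AdmissibleMeasure κ A ω) : StrongFunctional κ A (potential κ ω) := by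
  rcases hω.finite_energy_or with h | ⟨h1, h2, m, h3⟩
  · exact hκ.strongFunctional_of_mem_energyCone h
  · exact hκ.strongFunctional_of_bounded hF hω.radon h1 h2 h3

/-! ### Existence, uniqueness and minimality of the inner balayage. -/

theorem IsInnerBalayage.ae_eq (hκ : AdmissibleKernel κ) (hω : ω ∈ radonPos X)
    (h : IsInnerBalayage κ A ω μ) (hν : ν ∈ energyConeOn κ A) :
    ∀ᵐ x ∂ν, potential κ μ x = potential κ ω x :=
  hκ.ae_of_nearlyEverywhereOn (measurableSet_eq_fun (hκ.measurable_potential h.1.1.1)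
    (hκ.measurable_potential hω)) h.2 hν

/-- Both measures pair equally with every element of `ℰ⁺(A)`, in particular with each other and
themselves, so their strong distance is zero. -/
theorem IsInnerBalayage.unique (hκ : AdmissibleKernel κ) (hω : ω ∈ radonPos X)
    (hμ : IsInnerBalayage κ A ω μ) (hν : IsInnerBalayage κ A ω ν) : μ = ν := by
  have key : ∀ σ ∈ energyConeOn κ A, mutualEnergy κ σ μ = mutualEnergy κ σ ν := by
    intro σ hσ
    rw [hκ.mutualEnergy_eq hσ.1.1 hμ.1.1.1, hκ.mutualEnergy_eq hσ.1.1 hν.1.1.1]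
    refine lintegral_congr_ae ?_
    filter_upwards [hμ.ae_eq hκ hω hσ, hν.ae_eq hκ hω hσ] with x h1 h2 using h1.trans h2.symm
  refine hκ.eq_of_pairing_eq hμ.1.1 hν.1.1 ?_ ?_
  · rw [pairing, key μ hμ.1, pairing]
  · rw [pairing, ← key ν hν.1, hκ.mutualEnergy_comm hν.1.1.1 hμ.1.1.1, pairing]

theorem AdmissibleMeasure.exists_isInnerBalayage (hκ : AdmissibleKernel κ) (hA : AdmissibleSet κ A)
    (hF : FrostmanPrinciple κ) (hω : AdmissibleMeasure κ A ω) : ∃ ν, IsInnerBalayage κ A ω ν := by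
  obtain ⟨P, hP, -, h⟩ := hκ.exists_swept hA.strongly_closed hω.radon (hω.strongFunctional hκ hF)
  exact ⟨P, hP, nearlyEverywhereOn_of_ae h⟩

theorem IsInnerBalayage.hasMinimumMass (hκ : AdmissibleKernel κ) (hF : FrostmanPrinciple κ)
    (hω : ω ∈ radonPos X) (h : IsInnerBalayage κ A ω μ) : HasMinimumMass κ A ω μ := by
  refine ⟨⟨⟨h.1.1.1, nearlyEverywhereOn_of_ae fun ν hν => ?_⟩, h.1.1⟩, fun ν hν => ?_⟩
  · exact (h.ae_eq hκ hω hν).mono fun x hx => hx.ge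
  · refine hκ.measure_univ_le hF h.1 hν.2.1 fun σ hσ => ?_
    have hle := hκ.ae_of_nearlyEverywhereOn (measurableSet_le (hκ.measurable_potential hω)
      (hκ.measurable_potential hν.2.1)) hν.1.2 hσ
    filter_upwards [h.ae_eq hκ hω hσ, hle] with x h1 h2 using h1.trans_le h2

end General

/-! ### The two-point example of non-uniqueness. -/

section TwoPoint

/-- A strictly positive definite kernel on the two-point space. -/
def boolKernel (x y : Bool) : ℝ≥0∞ := if x && y then 2 else 1

variable {μ ν : Measure Bool}

theorem boolKernel_potential_false : potential boolKernel μ false = μ {false} + μ {true} := by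
  simp [potential, boolKernel, lintegral_fintype, add_comm]

theorem boolKernel_potential_true : potential boolKernel μ true = μ {false} + 2 * μ {true} := by
  simp [potential, boolKernel, lintegral_fintype, add_comm]

theorem measure_univ_bool : μ Set.univ = μ {false} + μ {true} := by
  rw [← measure_union (by simp) (measurableSet_singleton _)]
  congr 1
  ext x
  cases x <;> simp

theorem isFiniteMeasure_of_mem_radonPos (hμ : μ ∈ radonPos Bool) : IsFiniteMeasure μ := by
  have : IsLocallyFiniteMeasure μ := hμ
  infer_instance

theorem measure_bool_ext (h0 : μ {false} = ν {false}) (h1 : μ {true} = ν {true}) : μ = ν :=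
  Measure.ext_of_singleton fun x => by cases x <;> assumption

theorem boolKernel_mutualEnergy [IsFiniteMeasure μ] [IsFiniteMeasure ν] :
    mutualEnergy boolKernel μ ν = μ {false} * ν {false} + μ {false} * ν {true}
      + μ {true} * ν {false} + 2 * (μ {true} * ν {true}) := by
  rw [mutualEnergy, lintegral_prod _ (measurable_of_countable _).aemeasurable]
  change ∫⁻ x, potential boolKernel ν x ∂μ = _
  rw [lintegral_fintype, Fintype.sum_bool, boolKernel_potential_false, boolKernel_potential_true]
  ring

theorem boolKernel_mutualEnergy_ne_top [IsFiniteMeasure μ] [IsFiniteMeasure ν] :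
    mutualEnergy boolKernel μ ν ≠ ⊤ := by
  rw [boolKernel_mutualEnergy]
  have h := measure_ne_top μ
  have h' := measure_ne_top ν
  simp [ENNReal.mul_eq_top, h, h']

theorem mem_energyCone_boolKernel_iff : μ ∈ energyCone boolKernel ↔ IsFiniteMeasure μ := by
  refine ⟨fun h => isFiniteMeasure_of_mem_radonPos h.1, fun h => ⟨?_, ?_⟩⟩
  · exact (inferInstance : IsLocallyFiniteMeasure μ)
  · exact boolKernel_mutualEnergy_ne_top.lt_top

theorem boolKernel_toReal_mutualEnergy [IsFiniteMeasure μ] [IsFiniteMeasure ν] :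
    (mutualEnergy boolKernel μ ν).toReal = μ.real {false} * ν.real {false}
      + μ.real {false} * ν.real {true} + μ.real {true} * ν.real {false}
      + 2 * (μ.real {true} * ν.real {true}) := by
  have h := measure_ne_top μ
  have h' := measure_ne_top ν
  rw [boolKernel_mutualEnergy, ENNReal.toReal_add, ENNReal.toReal_add, ENNReal.toReal_add] <;>
    simp [ENNReal.mul_eq_top, h, h', Measure.real]

/-- Completing the square in the form `p² + 2pq + 2q²` makes strict positive definiteness visible
and identifies strong with coordinatewise convergence. -/
theorem boolKernel_strongDistSq [IsFiniteMeasure μ] [IsFiniteMeasure ν] :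
    strongDistSq boolKernel μ ν =
      ((μ.real {false} - ν.real {false}) + (μ.real {true} - ν.real {true})) ^ 2
        + (μ.real {true} - ν.real {true}) ^ 2 := by
  rw [strongDistSq, energy, energy, boolKernel_toReal_mutualEnergy, boolKernel_toReal_mutualEnergy,
    boolKernel_toReal_mutualEnergy]
  ring

theorem boolKernel_strongTendsto_iff {μ : ℕ → Measure Bool} {μ₀ : Measure Bool}
    (hμ : ∀ j, IsFiniteMeasure (μ j)) (hμ₀ : IsFiniteMeasure μ₀) :
    StrongTendsto boolKernel μ μ₀ ↔ ∀ b, Tendsto (fun j => (μ j).real {b}) atTop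
      (𝓝 (μ₀.real {b})) := by
  constructor
  · intro h
    rw [StrongTendsto] at h
    simp only [boolKernel_strongDistSq] at h
    have hs := h.sqrt
    rw [Real.sqrt_zero] at hs
    have ht : Tendsto (fun j => (μ j).real {true} - μ₀.real {true}) atTop (𝓝 0) :=
      squeeze_zero_norm (fun j => Real.abs_le_sqrt (le_add_of_nonneg_left (sq_nonneg _))) hs
    have hsum : Tendsto (fun j => ((μ j).real {false} - μ₀.real {false})
        + ((μ j).real {true} - μ₀.real {true})) atTop (𝓝 0) :=
      squeeze_zero_norm (fun j => Real.abs_le_sqrt (le_add_of_nonneg_right (sq_nonneg _))) hs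
    rintro (_ | _)
    · have := (hsum.sub ht).add_const (μ₀.real {false})
      simpa using this
    · have := ht.add_const (μ₀.real {true})
      simpa using this
  · intro h
    rw [StrongTendsto]
    simp only [boolKernel_strongDistSq]
    have h0 := (h false).sub_const (μ₀.real {false})
    have h1 := (h true).sub_const (μ₀.real {true})
    have := ((h0.add h1).pow 2).add (h1.pow 2)
    simpa using this

theorem boolKernel_energyPrinciple : EnergyPrinciple boolKernel := by
  intro μ hμ ν hν
  have := isFiniteMeasure_of_mem_radonPos hμ
  have := isFiniteMeasure_of_mem_radonPos hν
  have hd : strongDistSq boolKernel μ ν = (energy boolKernel μ + energy boolKernel ν).toReal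
      - (2 * mutualEnergy boolKernel μ ν).toReal := by
    rw [strongDistSq, energy, energy, ENNReal.toReal_add boolKernel_mutualEnergy_ne_top
      boolKernel_mutualEnergy_ne_top, ENNReal.toReal_mul, ENNReal.toReal_ofNat]
    ring
  rw [boolKernel_strongDistSq] at hd
  refine ⟨?_, fun _ heq => ?_⟩
  · rw [energy, energy] at hd ⊢
    rw [← ENNReal.toReal_le_toReal
      (ENNReal.mul_ne_top ENNReal.ofNat_ne_top boolKernel_mutualEnergy_ne_top)
      (ENNReal.add_ne_top.2 ⟨boolKernel_mutualEnergy_ne_top, boolKernel_mutualEnergy_ne_top⟩)]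
    nlinarith [sq_nonneg ((μ.real {false} - ν.real {false}) + (μ.real {true} - ν.real {true})),
      sq_nonneg (μ.real {true} - ν.real {true})]
  · rw [heq, sub_self] at hd
    have h1 : μ.real {true} - ν.real {true} = 0 := by
      rw [← sq_eq_zero_iff]
      nlinarith [sq_nonneg ((μ.real {false} - ν.real {false}) + (μ.real {true} - ν.real {true})),
        sq_nonneg (μ.real {true} - ν.real {true})]
    rw [h1] at hd
    have h0 : μ.real {false} - ν.real {false} = 0 := by
      rw [← sq_eq_zero_iff]
      linarith
    exact measure_bool_ext ((measureReal_eq_measureReal_iff).1 (sub_eq_zero.1 h0))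
      ((measureReal_eq_measureReal_iff).1 (sub_eq_zero.1 h1))

theorem boolKernel_consistencyPrinciple : ConsistencyPrinciple boolKernel := by
  constructor
  · intro μ hμ hc
    have hfin := fun j => mem_energyCone_boolKernel_iff.1 (hμ j)
    have hlim : ∀ b, ∃ l, Tendsto (fun j => (μ j).real {b}) atTop (𝓝 l) := by
      intro b
      refine cauchySeq_tendsto_of_complete (Metric.cauchySeq_iff.2 fun ε hε => ?_)
      -- Both squares are below `(ε/2)²`, and `p = (p + q) - q` costs two halves.
      obtain ⟨N, hN⟩ := hc (ε ^ 2 / 4) (by positivity)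
      refine ⟨N, fun i hi j hj => ?_⟩
      have h := hN i hi j hj
      rw [boolKernel_strongDistSq] at h
      set p := (μ i).real {false} - (μ j).real {false} with hp
      set q := (μ i).real {true} - (μ j).real {true} with hq
      rw [Real.dist_eq]
      have hq' : |q| < ε / 2 := abs_lt_of_sq_lt_sq (by nlinarith [sq_nonneg (p + q)]) (by positivity)
      have hpq : |p + q| < ε / 2 := abs_lt_of_sq_lt_sq (by nlinarith [sq_nonneg q]) (by positivity)
      cases b
      · rw [← hp, show p = (p + q) - q by ring]
        exact (abs_sub _ _).trans_lt (by linarith)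
      · rw [← hq]
        linarith
    choose l hl using hlim
    have hl0 : ∀ b, 0 ≤ l b := fun b => ge_of_tendsto' (hl b) fun j => measureReal_nonneg
    have hfin₀ : IsFiniteMeasure (ENNReal.ofReal (l false) • Measure.dirac false
        + ENNReal.ofReal (l true) • Measure.dirac true) := by
      refine ⟨?_⟩
      simp [ENNReal.add_lt_top]
    refine ⟨_, mem_energyCone_boolKernel_iff.2 hfin₀,
      (boolKernel_strongTendsto_iff hfin hfin₀).2 fun b => ?_⟩
    convert hl b using 2
    cases b <;> simp [Measure.real, hl0]
  · intro μ μ₀ hμ hμ₀ h φ _ _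
    have hfin := fun j => mem_energyCone_boolKernel_iff.1 (hμ j)
    have hfin₀ := mem_energyCone_boolKernel_iff.1 hμ₀
    have hb := (boolKernel_strongTendsto_iff hfin hfin₀).1 h
    have hi : ∀ (ν : Measure Bool) [IsFiniteMeasure ν],
        ∫ x, φ x ∂ν = ν.real {true} * φ true + ν.real {false} * φ false := by
      intro ν _
      rw [integral_fintype Integrable.of_finite, Fintype.sum_bool, smul_eq_mul, smul_eq_mul]
    simp only [hi]
    exact ((hb true).mul_const _).add ((hb false).mul_const _)

theorem ae_bool_iff {P : Bool → Prop} : (∀ᵐ x ∂μ, P x) ↔ ∀ b, μ {b} ≠ 0 → P b := by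
  rw [ae_iff_of_countable]

theorem boolKernel_dominationPrinciple : DominationPrinciple boolKernel := by
  intro μ hμ ν hν h
  have := mem_energyCone_boolKernel_iff.1 hμ
  have := isFiniteMeasure_of_mem_radonPos hν
  rw [ae_bool_iff] at h
  have h0 := h false
  have h1 := h true
  rw [boolKernel_potential_false, boolKernel_potential_false] at h0
  rw [boolKernel_potential_true, boolKernel_potential_true] at h1
  have hfμ := measure_ne_top μ {false}
  have htμ := measure_ne_top μ {true}
  have hfν := measure_ne_top ν {false}
  have htν := measure_ne_top ν {true}
  have key : (μ {false} + μ {true} ≤ ν {false} + ν {true}) ∧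
      (μ {false} + 2 * μ {true} ≤ ν {false} + 2 * ν {true}) := by
    lift μ {false} to ℝ≥0 using hfμ with a
    lift μ {true} to ℝ≥0 using htμ with b
    lift ν {false} to ℝ≥0 using hfν with c
    lift ν {true} to ℝ≥0 using htν with d
    norm_cast at h0 h1 ⊢
    rw [← NNReal.coe_eq_zero, ← NNReal.coe_le_coe] at h0 h1
    rw [← NNReal.coe_le_coe, ← NNReal.coe_le_coe]
    push_cast at h0 h1 ⊢
    have ha := a.coe_nonneg
    have hb := b.coe_nonneg
    have hc := c.coe_nonneg
    have hd := d.coe_nonneg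
    -- Only charged points give hypotheses. With mass at `false` alone, `a ≤ c + d` implies `a ≤ c +
    -- 2d`; with mass at `true` alone, `2b ≤ c + 2d` implies `b ≤ c + d`.
    by_cases ha0 : (a : ℝ) = 0 <;> by_cases hb0 : (b : ℝ) = 0 <;>
      simp only [ha0, hb0, not_true_eq_false, not_false_eq_true, false_imp_iff, true_imp_iff]
        at h0 h1 ⊢ <;>
      constructor <;> linarith
  rintro (_ | _)
  · rw [boolKernel_potential_false, boolKernel_potential_false]; exact key.1
  · rw [boolKernel_potential_true, boolKernel_potential_true]; exact key.2

theorem boolKernel_frostmanPrinciple : FrostmanPrinciple boolKernel := by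
  intro μ hμ c hc h
  rw [ae_bool_iff] at h
  have h0 := h false
  have h1 := h true
  rw [boolKernel_potential_false] at h0
  rw [boolKernel_potential_true] at h1
  have hle : μ {false} + μ {true} ≤ μ {false} + 2 * μ {true} := by
    gcongr
    exact le_mul_of_one_le_left' one_le_two
  -- The potential is largest at `true`; if `true` carries no mass, both values coincide.
  have key : μ {false} + 2 * μ {true} ≤ c := by
    by_cases ht : μ {true} = 0
    · by_cases hf : μ {false} = 0
      · simp [ht, hf]
      · simpa [ht] using h0 hf
    · exact h1 ht
  rw [ENNReal.coe_one, one_mul]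
  rintro (_ | _)
  · rw [boolKernel_potential_false]; exact hle.trans key
  · rw [boolKernel_potential_true]; exact key

theorem boolKernel_admissible : AdmissibleKernel boolKernel where
  symm x y := by simp only [boolKernel, Bool.and_comm]
  lsc := continuous_of_discreteTopology.lowerSemicontinuous
  energy_principle := boolKernel_energyPrinciple
  consistency := boolKernel_consistencyPrinciple
  domination := boolKernel_dominationPrinciple
  ugaheri := ⟨1, le_rfl, boolKernel_frostmanPrinciple⟩

theorem dirac_false_mem : Measure.dirac false ∈ energyConeOn boolKernel {false} :=
  ⟨mem_energyCone_boolKernel_iff.2 inferInstance, by simp⟩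

theorem dirac_true_mem : Measure.dirac true ∈ energyCone boolKernel :=
  mem_energyCone_boolKernel_iff.2 inferInstance

theorem boolKernel_admissibleSet : AdmissibleSet boolKernel {false} where
  capacity_pos := by
    refine (pos_iff_ne_zero.2 (compactCapacity_ne_zero dirac_false_mem (by simp))).trans_le ?_
    exact le_iSup₂_of_le {false} ⟨isCompact_singleton, subset_rfl⟩ le_rfl
  strongly_closed := boolKernel_admissible.stronglyClosedOn_of_isCompact isCompact_singleton

theorem dirac_true_admissible : AdmissibleMeasure boolKernel {false} (Measure.dirac true) where
  radon := dirac_true_mem.1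
  ne_zero h := by simpa using congrArg (fun μ : Measure Bool => μ Set.univ) h
  finite_energy_or := Or.inl dirac_true_mem

/-- The unit mass at `false` has finite energy, so the point has positive capacity and cannot be
exceptional. -/
theorem nearlyEverywhereOn_false_iff {P : Bool → Prop} :
    NearlyEverywhereOn boolKernel {false} P ↔ P false := by
  refine ⟨fun h => ?_, fun h => nearlyEverywhereOn_of_ae fun μ hμ => ?_⟩
  · have := boolKernel_admissible.ae_of_nearlyEverywhereOn (Set.toFinite _).measurableSet h
      dirac_false_mem
    exact ae_bool_iff.1 this false (by simp)
  · exact (mem_ae_of_mem_energyConeOn hμ).mono fun x hx => by rwa [Set.mem_singleton_iff.1 hx]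

theorem dirac_false_isInnerBalayage :
    IsInnerBalayage boolKernel {false} (Measure.dirac true) (Measure.dirac false) := by
  refine ⟨dirac_false_mem, nearlyEverywhereOn_false_iff.2 ?_⟩
  rw [boolKernel_potential_false, boolKernel_potential_false]
  simp

/-- Since `U^ν(false) = ν(X)`, the constraint on `A` is just `ν(X) ≥ 1` and does not see how the
mass is distributed. -/
theorem hasMinimumMass_boolKernel_iff :
    HasMinimumMass boolKernel {false} (Measure.dirac true) μ ↔ μ Set.univ = 1 := by
  have hpot : ∀ ν : Measure Bool, potential boolKernel ν false = ν Set.univ := fun ν => by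
    rw [boolKernel_potential_false, measure_univ_bool]
  have hΓ : ∀ ν : Measure Bool,
      ν ∈ GammaClass boolKernel {false} (Measure.dirac true) ∩ energyCone boolKernel ↔
        IsFiniteMeasure ν ∧ 1 ≤ ν Set.univ := by
    intro ν
    rw [Set.mem_inter_iff, mem_energyCone_boolKernel_iff, GammaClass, Set.mem_ofPred_eq,
      nearlyEverywhereOn_false_iff, hpot, hpot, measure_univ, and_comm]
    refine and_congr_right fun h => and_iff_right ?_
    exact (mem_energyCone_boolKernel_iff.2 h).1
  simp only [HasMinimumMass, hΓ]
  constructor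
  · rintro ⟨⟨-, h1⟩, h2⟩
    exact le_antisymm (by simpa using h2 (Measure.dirac true) ⟨inferInstance, by simp⟩) h1
  · intro h
    exact ⟨⟨⟨h.trans_lt ENNReal.one_lt_top⟩, h.ge⟩, fun ν hν => h.le.trans hν.2⟩

theorem hasMinimumMass_convexCombination {a b : ℝ≥0} (hab : a + b = 1) :
    HasMinimumMass boolKernel {false} (Measure.dirac true)
      (a • Measure.dirac true + b • Measure.dirac false) := by
  rw [hasMinimumMass_boolKernel_iff, Measure.add_apply, Measure.smul_apply, Measure.smul_apply,
    measure_univ, measure_univ, ENNReal.smul_def, ENNReal.smul_def, smul_eq_mul, smul_eq_mul,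
    mul_one, mul_one, ← ENNReal.coe_add, hab, ENNReal.coe_one]

theorem infinite_hasMinimumMass :
    {μ : Measure Bool | HasMinimumMass boolKernel {false} (Measure.dirac true) μ}.Infinite := by
  refine Set.infinite_of_injOn_mapsTo (s := Set.Icc (0 : ℝ≥0) 1)
    (f := fun a => a • Measure.dirac true + (1 - a) • Measure.dirac false) ?_ ?_
    (Set.Icc_infinite zero_lt_one)
  · have e : ∀ a : ℝ≥0, (a • Measure.dirac true + (1 - a) • Measure.dirac false : Measure Bool)
        {true} = a := fun a => by
      rw [Measure.add_apply, Measure.smul_apply, Measure.smul_apply]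
      simp [ENNReal.smul_def]
    intro a _ b _ hab
    have h := congrArg (fun μ : Measure Bool => μ {true}) hab
    exact ENNReal.coe_injective ((e a).symm.trans (h.trans (e b)))
  · exact fun a ha => hasMinimumMass_convexCombination (add_tsub_cancel_of_le ha.2)

end TwoPoint

end Balayage

theorem mainTheorem11 :
    (∀ (X : Type*) [TopologicalSpace X] [T2Space X] [LocallyCompactSpace X]
        [SecondCountableTopology X] [MeasurableSpace X] [BorelSpace X]
        (κ : X → X → ℝ≥0∞) (A : Set X) (ω : Measure X),
        Balayage.AdmissibleKernel κ → Balayage.AdmissibleSet κ A →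
        Balayage.AdmissibleMeasure κ A ω → Balayage.FrostmanPrinciple κ →
        (∃! ν : Measure X, Balayage.IsInnerBalayage κ A ω ν) ∧
        ∀ ν : Measure X, Balayage.IsInnerBalayage κ A ω ν → Balayage.HasMinimumMass κ A ω ν) ∧
    (∃ (X : Type) (_ : TopologicalSpace X) (_ : T2Space X) (_ : LocallyCompactSpace X)
        (_ : SecondCountableTopology X) (_ : MeasurableSpace X) (_ : BorelSpace X)
        (κ : X → X → ℝ≥0∞) (A : Set X) (ω ωA : Measure X),
        Balayage.AdmissibleKernel κ ∧ Balayage.AdmissibleSet κ A ∧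
        Balayage.AdmissibleMeasure κ A ω ∧ Balayage.FrostmanPrinciple κ ∧
        Balayage.IsInnerBalayage κ A ω ωA ∧
        ω ∈ Balayage.energyCone κ ∧ ω Set.univ < ⊤ ∧ ω ≠ ωA ∧ ω Set.univ = ωA Set.univ ∧
        (∀ a b : ℝ≥0, a + b = 1 → Balayage.HasMinimumMass κ A ω (a • ω + b • ωA)) ∧
        {μ : Measure X | Balayage.HasMinimumMass κ A ω μ}.Infinite) := by
  constructor
  · intro X _ _ _ _ _ _ κ A ω hκ hA hω hF
    refine ⟨?_, fun ν hν => hν.hasMinimumMass hκ hF hω.radon⟩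
    obtain ⟨ν, hν⟩ := hω.exists_isInnerBalayage hκ hA hF
    exact ⟨ν, hν, fun ρ hρ => hρ.unique hκ hω.radon hν⟩
  · refine ⟨Bool, inferInstance, inferInstance, inferInstance, inferInstance, inferInstance,
      inferInstance, Balayage.boolKernel, {false}, Measure.dirac true, Measure.dirac false,
      Balayage.boolKernel_admissible, Balayage.boolKernel_admissibleSet,
      Balayage.dirac_true_admissible, Balayage.boolKernel_frostmanPrinciple,
      Balayage.dirac_false_isInnerBalayage, Balayage.dirac_true_mem, by simp, ?_, by simp,
      fun a b hab => Balayage.hasMinimumMass_convexCombination hab,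
      Balayage.infinite_hasMinimumMass⟩
    intro h
    simpa using congrArg (fun μ : Measure Bool => μ {true}) h
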